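/- Let $c>1$ be a real number that is not an integer. There exist constants $\theta>0$, $\delta>0$ and $C$, depending only on $c$, such that for all positive integers $N$ and all integers $m,u$ with $1\le m\le N^{\theta}$ and $0\le u<m$, $$\Bigl|\sum_{\substack{1\le n\le N\\ \lfloor n^c\rfloor\equiv u \bmod m}}\Lambda(n)-\frac{\Psi(N)}{m}\Bigr|\le C\Bigl(\frac{N}{m}\Bigr)^{1-\delta},$$ where $\Lambda$ is the von Mangoldt function ($\Lambda(p^k)=\log p$ for primes $p$ and $k\ge1$, and $\Lambda(n)=0$ otherwise) and $\Psi(N)=\sum_{n\le N}\Lambda(n)$. -/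

import Mathlib

/-!
The congruence `⌊n ^ c⌋ ≡ u (mod m)` says that the fractional part of `(n ^ c - u) / m` is less than
`1 / m`. Averaging the nonnegative kernels `‖∑ r < H, 𝐞 (r x)‖ ^ 2` over short grids of translates
gives majorants and minorants of such a condition whose nonzero frequencies are multiples of
`1 / m`, so it is enough to save a power of `N` in `∑ n ≤ N, Λ n * 𝐞 (α * n ^ c)` for `α = r / m`.
Vaughan's identity turns this into bilinear sums, and these, after Cauchy–Schwarz, into sums of
`𝐞 (β * n ^ c)` over intervals. The `k`-th derivative of `β * x ^ c` is
`β * c * (c - 1) * ⋯ * (c - k + 1) * x ^ (c - k)`, whose coefficient does not vanish because `c` is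
not an integer; on a dyadic block it therefore has constant size, and van der Corput's `k`-th
difference test saves a power once `k` is chosen according to the size of `β`.
-/

open Finset Real

open scoped ArithmeticFunction.Moebius ArithmeticFunction.vonMangoldt ArithmeticFunction.zeta
  ComplexConjugate FourierTransform fwdDiff

/-! ### Phases and correlations -/

lemma norm_one_sub_fourierChar (x : ℝ) : ‖1 - (𝐞 x : ℂ)‖ = 2 * |sin (π * x)| := by
  rw [norm_sub_rev, fourierChar_apply, mul_comm, Complex.norm_exp_I_mul_ofReal_sub_one,
    show 2 * π * x / 2 = π * x by ring, norm_mul, norm_two, norm_eq_abs]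

lemma fourierChar_eq_one_iff {x : ℝ} : 𝐞 x = 1 ↔ ∃ k : ℤ, x = k := by
  rw [Circle.ext_iff, fourierChar_apply, Circle.coe_one, Complex.exp_eq_one_iff]
  refine exists_congr fun k ↦ ?_
  rw [show ((2 * π * x : ℝ) : ℂ) * Complex.I = x * (2 * π * Complex.I) by push_cast; ring,
    mul_left_inj' Complex.two_pi_I_ne_zero]
  norm_cast

lemma fourierChar_sub_intCast (x : ℝ) (k : ℤ) : 𝐞 (x - k) = 𝐞 x := by
  rw [AddChar.map_sub_eq_div, fourierChar_eq_one_iff.2 ⟨k, rfl⟩, div_one]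

lemma fourierChar_natCast_mul (n : ℕ) (x : ℝ) : 𝐞 (n * x) = 𝐞 x ^ n := by
  rw [← nsmul_eq_mul, AddChar.map_nsmul_eq_pow]

lemma coe_fourierChar_neg (x : ℝ) : (𝐞 (-x) : ℂ) = conj (𝐞 x : ℂ) := by
  rw [AddChar.map_neg_eq_inv, Circle.coe_inv_eq_conj]

lemma coe_fourierChar_sub (x y : ℝ) : (𝐞 (x - y) : ℂ) = 𝐞 x * conj (𝐞 y : ℂ) := by
  rw [sub_eq_add_neg, AddChar.map_add_eq_mul, Circle.coe_mul, coe_fourierChar_neg]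

lemma norm_sum_mul_fourierChar_neg {ι : Type*} (s : Finset ι) (w f : ι → ℝ) :
    ‖∑ n ∈ s, (w n : ℂ) * 𝐞 (-f n)‖ = ‖∑ n ∈ s, (w n : ℂ) * 𝐞 (f n)‖ := by
  rw [← RCLike.norm_conj (∑ n ∈ s, (w n : ℂ) * 𝐞 (f n)), map_sum]
  simp only [map_mul, Complex.conj_ofReal, coe_fourierChar_neg]

lemma norm_sum_fourierChar_le_card {ι : Type*} (s : Finset ι) (f : ι → ℝ) :
    ‖∑ n ∈ s, (𝐞 (f n) : ℂ)‖ ≤ #s :=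
  (norm_sum_le_of_le s fun _ _ ↦ (Circle.norm_coe _).le).trans_eq (by rw [sum_const, nsmul_one])

lemma four_mul_abs_sub_round_le (x : ℝ) : 4 * |x - round x| ≤ ‖1 - (𝐞 x : ℂ)‖ := by
  rw [← fourierChar_sub_intCast x (round x), norm_one_sub_fourierChar]
  have h := mul_abs_le_abs_sin (x := π * (x - round x)) (by
    rw [abs_mul, abs_of_pos pi_pos]
    nlinarith [abs_sub_round x, pi_pos])
  have hpi : 2 / π * (π * |x - round x|) = 2 * |x - round x| := by field_simp
  rw [abs_mul, abs_of_pos pi_pos, hpi] at h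
  linarith

lemma le_abs_sub_round {x D : ℝ} (j : ℤ) (h₁ : j + D ≤ x) (h₂ : x ≤ j + 1 - D) :
    D ≤ |x - round x| := by
  rcases le_or_gt (round x) j with h | h
  · have : (round x : ℝ) ≤ j := by exact_mod_cast h
    exact (by linarith : D ≤ x - round x).trans (le_abs_self _)
  · have : (j : ℝ) + 1 ≤ round x := by exact_mod_cast h
    exact (by linarith : D ≤ -(x - round x)).trans (neg_le_abs _)

lemma sum_mul_norm_sum_sq_eq {ι κ : Type*} (s : Finset ι) (t : Finset κ) (w : ι → ℝ)
    (a : κ → ι → ℂ) : ∑ n ∈ s, w n * ‖∑ k ∈ t, a k n‖ ^ 2 =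
      ∑ k ∈ t, ∑ l ∈ t, (∑ n ∈ s, w n * (a k n * conj (a l n))).re := by
  have hexpand (n : ι) : ((w n * ‖∑ k ∈ t, a k n‖ ^ 2 : ℝ) : ℂ) =
      ∑ k ∈ t, ∑ l ∈ t, w n * (a k n * conj (a l n)) := by
    rw [Complex.ofReal_mul, Complex.ofReal_pow, ← Complex.mul_conj', map_sum, sum_mul_sum]
    simp only [mul_sum]
  simp only [← Complex.re_sum]
  rw [sum_congr rfl fun k _ ↦ sum_comm, sum_comm, ← sum_congr rfl fun n _ ↦ hexpand n,
    ← Complex.ofReal_sum, Complex.ofReal_re]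

lemma sum_mul_norm_sum_sq_le {ι κ : Type*} [LinearOrder κ] {s : Finset ι} {t : Finset κ}
    {w : ι → ℝ} {a : κ → ι → ℂ} {b : κ → ℝ} {A B : ℝ} (hB : 0 ≤ B)
    (hdiag : ∀ k ∈ t, ∑ n ∈ s, w n * ‖a k n‖ ^ 2 ≤ A * b k ^ 2)
    (hoff : ∀ k ∈ t, ∀ l ∈ t, k < l → ‖∑ n ∈ s, w n * (a k n * conj (a l n))‖ ≤ B * (b k * b l)) :
    ∑ n ∈ s, w n * ‖∑ k ∈ t, a k n‖ ^ 2 ≤ A * ∑ k ∈ t, b k ^ 2 + B * (∑ k ∈ t, b k) ^ 2 := by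
  have hterm : ∀ k ∈ t, ∀ l ∈ t, (∑ n ∈ s, w n * (a k n * conj (a l n))).re ≤
      (if k = l then A * b k ^ 2 else 0) + B * (b k * b l) := by
    intro k hk l hl
    rcases lt_trichotomy k l with hkl | rfl | hlk
    · rw [if_neg hkl.ne, zero_add]
      exact (Complex.re_le_norm _).trans (hoff k hk l hl hkl)
    · have hreal : (∑ n ∈ s, w n * (a k n * conj (a k n))).re = ∑ n ∈ s, w n * ‖a k n‖ ^ 2 := by
        simp only [Complex.mul_conj', Complex.re_sum, ← Complex.ofReal_pow, ← Complex.ofReal_mul,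
          Complex.ofReal_re]
      rw [if_pos rfl, hreal]
      linarith [hdiag k hk, mul_nonneg hB (mul_self_nonneg (b k))]
    · have hconj : ∑ n ∈ s, w n * (a k n * conj (a l n)) =
          conj (∑ n ∈ s, w n * (a l n * conj (a k n))) := by
        simp only [map_sum, map_mul, Complex.conj_ofReal, Complex.conj_conj, mul_comm (a k _)]
      rw [if_neg hlk.ne', zero_add, hconj, Complex.conj_re, mul_comm (b k)]
      exact (Complex.re_le_norm _).trans (hoff l hl k hk hlk)
  rw [sum_mul_norm_sum_sq_eq]
  refine (sum_le_sum fun k hk ↦ sum_le_sum fun l hl ↦ hterm k hk l hl).trans_eq ?_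
  rw [sq (∑ k ∈ t, b k), sum_mul_sum]
  simp only [sum_add_distrib, sum_ite_eq, mul_sum]
  rw [sum_congr rfl fun k hk ↦ if_pos hk]

/-! ### The Kusmin–Landau inequality and the second difference test -/

lemma inv_one_sub_fourierChar {t : ℝ} (ht : sin (π * t) ≠ 0) :
    (1 - (𝐞 t : ℂ))⁻¹ = 1 / 2 + (cot (π * t) / 2 : ℝ) * Complex.I := by
  set θ := π * t with hθ
  have hphase : (𝐞 t : ℂ) = (1 - 2 * sin θ ^ 2 : ℝ) + (2 * sin θ * cos θ : ℝ) * Complex.I := by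
    rw [fourierChar_apply, Complex.exp_mul_I, ← Complex.ofReal_cos, ← Complex.ofReal_sin,
      mul_assoc, ← hθ, cos_two_mul', sin_two_mul, cos_sq']
    ring_nf
  refine inv_eq_of_mul_eq_one_left ?_
  have hsin : (sin θ : ℂ) ≠ 0 := Complex.ofReal_ne_zero.2 ht
  have hsq : (sin θ : ℂ) ^ 2 + (cos θ : ℂ) ^ 2 = 1 := by exact_mod_cast sin_sq_add_cos_sq θ
  rw [hphase, cot_eq_cos_div_sin, Complex.ofReal_div, Complex.ofReal_div]
  simp only [Complex.ofReal_mul, Complex.ofReal_sub, Complex.ofReal_pow, Complex.ofReal_one,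
    Complex.ofReal_ofNat]
  field_simp
  linear_combination 2 * (sin θ : ℂ) * hsq - 2 * (sin θ : ℂ) * (cos θ : ℂ) ^ 2 * Complex.I_sq

lemma antitoneOn_cot_pi_mul : AntitoneOn (fun t ↦ cot (π * t)) (Set.Ioo 0 1) := by
  intro s hs t ht hst
  have hsin {x : ℝ} (hx : x ∈ Set.Ioo (0 : ℝ) 1) : 0 < sin (π * x) :=
    sin_pos_of_pos_of_lt_pi (mul_pos pi_pos hx.1) (by nlinarith [pi_pos, hx.2])
  have hsub : 0 ≤ sin (π * t - π * s) := by
    rw [← mul_sub]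
    exact sin_nonneg_of_nonneg_of_le_pi (mul_nonneg pi_pos.le (sub_nonneg.2 hst))
      (by nlinarith [pi_pos, ht.2, hs.1])
  rw [sin_sub] at hsub
  simp only [cot_eq_cos_div_sin]
  rw [div_le_div_iff₀ (hsin ht) (hsin hs)]
  linarith

lemma norm_inv_one_sub_fourierChar_sub {s t : ℝ} (hs : 0 < s) (hst : s ≤ t) (ht : t < 1) :
    ‖(1 - (𝐞 t : ℂ))⁻¹ - (1 - (𝐞 s : ℂ))⁻¹‖ = cot (π * s) / 2 - cot (π * t) / 2 := by
  have hsin {x : ℝ} (h₀ : 0 < x) (h₁ : x < 1) : sin (π * x) ≠ 0 :=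
    (sin_pos_of_pos_of_lt_pi (mul_pos pi_pos h₀) (by nlinarith [pi_pos])).ne'
  have hanti : cot (π * t) ≤ cot (π * s) :=
    antitoneOn_cot_pi_mul ⟨hs, hst.trans_lt ht⟩ ⟨hs.trans_le hst, ht⟩ hst
  rw [inv_one_sub_fourierChar (hsin (hs.trans_le hst) ht),
    inv_one_sub_fourierChar (hsin hs (hst.trans_lt ht)), add_sub_add_left_eq_sub, ← sub_mul,
    ← Complex.ofReal_sub, norm_mul, Complex.norm_I, mul_one, Complex.norm_real, norm_eq_abs,
    abs_of_nonpos (by linarith), neg_sub]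

lemma norm_sum_le_of_eq_mul_sub {g w : ℕ → ℂ} {M : ℕ} (hg : ∀ n, ‖g n‖ ≤ 1)
    (hw : ∀ n < M + 1, g n = w n * (g n - g (n + 1))) :
    ‖∑ n ∈ range (M + 1), g n‖ ≤ ‖w 0‖ + ‖w M‖ + ∑ n ∈ range M, ‖w (n + 1) - w n‖ := by
  have hparts (m : ℕ) : ∑ n ∈ range (m + 1), w n * (g n - g (n + 1)) =
      w 0 * g 0 - w m * g (m + 1) + ∑ n ∈ range m, (w (n + 1) - w n) * g (n + 1) := by
    induction m with
    | zero => simp [mul_sub]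
    | succ m ih => rw [sum_range_succ, ih, sum_range_succ _ m]; ring
  have hle (a : ℂ) (n : ℕ) : ‖a * g n‖ ≤ ‖a‖ := by
    rw [norm_mul]
    exact mul_le_of_le_one_right (norm_nonneg a) (hg n)
  rw [sum_congr rfl fun n hn ↦ hw n (mem_range.1 hn), hparts]
  refine (norm_add_le _ _).trans (add_le_add ?_ (norm_sum_le_of_le _ fun n _ ↦ hle _ _))
  exact (norm_sub_le _ _).trans (add_le_add (hle _ _) (hle _ _))

lemma sum_norm_inv_one_sub_fourierChar_sub {d : ℕ → ℝ} {M : ℕ} (j : ℤ)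
    (hd : ∀ n ≤ M, d n ∈ Set.Ioo (j : ℝ) (j + 1)) (hmono : MonotoneOn d (Set.Iic M)) :
    ∑ n ∈ range M, ‖(1 - (𝐞 (d (n + 1)) : ℂ))⁻¹ - (1 - (𝐞 (d n) : ℂ))⁻¹‖ =
      ‖(1 - (𝐞 (d M) : ℂ))⁻¹ - (1 - (𝐞 (d 0) : ℂ))⁻¹‖ := by
  have hjump {a b : ℕ} (hab : a ≤ b) (hb : b ≤ M) :
      ‖(1 - (𝐞 (d b) : ℂ))⁻¹ - (1 - (𝐞 (d a) : ℂ))⁻¹‖ =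
        cot (π * (d a - j)) / 2 - cot (π * (d b - j)) / 2 := by
    rw [← norm_inv_one_sub_fourierChar_sub (by linarith [(hd a (hab.trans hb)).1])
      (sub_le_sub_right (hmono (hab.trans hb) hb hab) _) (by linarith [(hd b hb).2]),
      fourierChar_sub_intCast, fourierChar_sub_intCast]
  rw [hjump M.zero_le le_rfl, ← sum_range_sub' fun n ↦ cot (π * (d n - j)) / 2]
  exact sum_congr rfl fun n hn ↦ hjump n.le_succ (mem_range.1 hn)

lemma norm_sum_fourierChar_le_of_monotoneOn {f : ℕ → ℝ} {M : ℕ} {D : ℝ} (j : ℤ) (hD : 0 < D)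
    (hf : ∀ n < M, Δ_[1] f n ∈ Set.Icc (j + D) (j + 1 - D))
    (hmono : MonotoneOn (Δ_[1] f) (Set.Iio M)) :
    ‖∑ n ∈ range M, (𝐞 (f n) : ℂ)‖ ≤ 1 / D := by
  obtain _ | M := M
  · simpa using hD.le
  set w : ℕ → ℂ := fun n ↦ (1 - (𝐞 (Δ_[1] f n) : ℂ))⁻¹ with hw
  have hdist (n : ℕ) (hn : n < M + 1) : 4 * D ≤ ‖1 - (𝐞 (Δ_[1] f n) : ℂ)‖ :=
    (mul_le_mul_of_nonneg_left (le_abs_sub_round j (hf n hn).1 (hf n hn).2) (by norm_num)).trans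
      (four_mul_abs_sub_round_le _)
  have hw_le (n : ℕ) (hn : n < M + 1) : ‖w n‖ ≤ 1 / (4 * D) := by
    rw [hw, norm_inv, ← one_div]
    exact one_div_le_one_div_of_le (by positivity) (hdist n hn)
  have hvar : ∑ n ∈ range M, ‖w (n + 1) - w n‖ = ‖w M - w 0‖ := by
    refine sum_norm_inv_one_sub_fourierChar_sub j (fun n hn ↦ ?_)
      (hmono.mono fun n ↦ Nat.lt_succ_of_le)
    obtain ⟨h₁, h₂⟩ := hf n (Nat.lt_succ_of_le hn)
    exact ⟨by linarith, by linarith⟩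
  have hparts := norm_sum_le_of_eq_mul_sub (g := fun n ↦ (𝐞 (f n) : ℂ)) (w := w) (M := M)
    (fun n ↦ (Circle.norm_coe _).le) fun n hn ↦ by
      have hne : 1 - (𝐞 (Δ_[1] f n) : ℂ) ≠ 0 :=
        norm_pos_iff.1 ((by positivity : 0 < 4 * D).trans_le (hdist n hn))
      have hsucc : f (n + 1) = f n + Δ_[1] f n := by rw [fwdDiff, add_sub_cancel]
      rw [hsucc, AddChar.map_add_eq_mul, Circle.coe_mul, ← mul_one_sub, hw]
      field_simp
  rw [hvar] at hparts
  have hsub := norm_sub_le (w M) (w 0)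
  have h₀ := hw_le 0 M.succ_pos
  have hM := hw_le M M.lt_succ_self
  calc _ ≤ _ := hparts
    _ ≤ 4 * (1 / (4 * D)) := by linarith
    _ = 1 / D := by field_simp

lemma sub_mem_Icc_of_fwdDiff_mem_Icc {g : ℕ → ℝ} {a b : ℕ} {L U : ℝ} (hab : a ≤ b)
    (hg : ∀ n ∈ Ico a b, Δ_[1] g n ∈ Set.Icc L U) :
    g b - g a ∈ Set.Icc (L * (b - a)) (U * (b - a)) := by
  have hcard : (#(Ico a b) : ℝ) = b - a := by rw [Nat.card_Ico, Nat.cast_sub hab]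
  rw [← sum_Ico_sub g hab, mul_comm L, mul_comm U, ← hcard, ← nsmul_eq_mul, ← nsmul_eq_mul]
  exact ⟨card_nsmul_le_sum _ _ _ fun n hn ↦ (hg n hn).1,
    sum_le_card_nsmul _ _ _ fun n hn ↦ (hg n hn).2⟩

lemma card_le_of_le_fwdDiff {d : ℕ → ℝ} {M : ℕ} {lam D x : ℝ} {S : Finset ℕ} (hlam : 0 < lam)
    (hD : 0 ≤ D) (hd : ∀ n, n + 1 < M → lam ≤ Δ_[1] d n)
    (hS : ∀ n ∈ S, n < M ∧ d n ∈ Set.Icc x (x + D)) : (#S : ℝ) ≤ D / lam + 1 := by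
  rcases S.eq_empty_or_nonempty with rfl | hne
  · rw [card_empty, Nat.cast_zero]
    positivity
  set a := S.min' hne
  set b := S.max' hne
  have hab : a ≤ b := S.min'_le _ (S.max'_mem hne)
  obtain ⟨hbM, hb⟩ := hS b (S.max'_mem hne)
  obtain ⟨-, ha⟩ := hS a (S.min'_mem hne)
  have hcard : (#S : ℝ) ≤ b - a + 1 := by
    have h := card_le_card (t := Ico a (b + 1)) fun n hn ↦
      mem_Ico.2 ⟨S.min'_le n hn, Nat.lt_succ_of_le (S.le_max' n hn)⟩
    rw [Nat.card_Ico] at h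
    rw [← Nat.cast_sub hab]
    exact_mod_cast h.trans (by omega)
  have hgrow : lam * (b - a) ≤ d b - d a := by
    rw [← sum_Ico_sub d hab, ← Nat.cast_sub hab, mul_comm, ← nsmul_eq_mul, ← Nat.card_Ico]
    exact card_nsmul_le_sum _ _ _ fun n hn ↦
      hd n ((Nat.succ_le_of_lt (mem_Ico.1 hn).2).trans_lt hbM)
  have : (b - a : ℝ) ≤ D / lam := by
    rw [le_div_iff₀' hlam]
    linarith [ha.1, hb.2]
  linarith

lemma exists_eq_Ico_of_ordConnected {S : Finset ℕ} (hS : (S : Set ℕ).OrdConnected) :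
    ∃ a b, S = Ico a b := by
  rcases S.eq_empty_or_nonempty with rfl | hne
  · exact ⟨0, 0, rfl⟩
  refine ⟨S.min' hne, S.max' hne + 1, ext fun n ↦ ⟨fun hn ↦ mem_Ico.2
    ⟨S.min'_le n hn, Nat.lt_succ_of_le (S.le_max' n hn)⟩, fun hn ↦ ?_⟩⟩
  obtain ⟨h₁, h₂⟩ := mem_Ico.1 hn
  exact hS.out (S.min'_mem hne) (S.max'_mem hne) ⟨h₁, Nat.le_of_lt_succ h₂⟩

lemma norm_sum_filter_fourierChar_le {f : ℕ → ℝ} {M : ℕ} {D : ℝ} (j : ℤ) (hD : 0 < D)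
    (hmono : MonotoneOn (Δ_[1] f) (Set.Iio M)) :
    ‖∑ n ∈ range M with Δ_[1] f n ∈ Set.Icc (j + D) (j + 1 - D), (𝐞 (f n) : ℂ)‖ ≤ 1 / D := by
  obtain ⟨a, b, hab⟩ := exists_eq_Ico_of_ordConnected
    (S := {n ∈ range M | Δ_[1] f n ∈ Set.Icc (j + D) (j + 1 - D)}) ⟨fun x hx y hy n hn ↦ by
      simp only [coe_filter, mem_range, Set.mem_ofPred_eq] at hx hy ⊢
      have hnM : n < M := hn.2.trans_lt hy.1
      exact ⟨hnM, hx.2.1.trans (hmono hx.1 hnM hn.1), (hmono hnM hy.1 hn.2).trans hy.2.2⟩⟩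
  have hmem {n : ℕ} (hn : n < b - a) :
      a + n < M ∧ Δ_[1] f (a + n) ∈ Set.Icc (j + D) (j + 1 - D) := by
    simpa using hab.symm.subset (mem_Ico.2 ⟨a.le_add_right n, by omega⟩)
  rw [hab, sum_Ico_eq_sum_range]
  exact norm_sum_fourierChar_le_of_monotoneOn (f := fun n ↦ f (a + n)) j hD
    (fun n hn ↦ (hmem hn).2) fun m hm n hn hmn ↦
      hmono (hmem hm).1 (hmem hn).1 (Nat.add_le_add_left hmn a)

lemma norm_sum_fourierChar_fiber_le {f : ℕ → ℝ} {M : ℕ} {lam D : ℝ} (j : ℤ) (hlam : 0 < lam)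
    (hD : 0 < D) (hd : ∀ n, n + 1 < M → lam ≤ Δ_[1] ^[2] f n)
    (hmono : MonotoneOn (Δ_[1] f) (Set.Iio M)) :
    ‖∑ n ∈ range M with ⌊Δ_[1] f n⌋ = j, (𝐞 (f n) : ℂ)‖ ≤ 1 / D + 2 * (D / lam + 1) := by
  set S := {n ∈ range M | ⌊Δ_[1] f n⌋ = j}
  have hcover (n : ℕ) (hn : n ∈ S) : n < M ∧ Δ_[1] f n ∈ Set.Ico (j : ℝ) (j + 1) := by
    have h := mem_filter.1 hn
    exact ⟨mem_range.1 h.1, Int.floor_eq_iff.1 h.2⟩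
  have hinner : {n ∈ S | Δ_[1] f n ∈ Set.Icc (j + D) (j + 1 - D)} =
      {n ∈ range M | Δ_[1] f n ∈ Set.Icc (j + D) (j + 1 - D)} := by
    rw [filter_filter]
    refine filter_congr fun n _ ↦ and_iff_right_of_imp fun h ↦ Int.floor_eq_iff.2 ?_
    exact ⟨by linarith [h.1], by linarith [h.2]⟩
  have hleft : (#{n ∈ S | Δ_[1] f n < j + D} : ℝ) ≤ D / lam + 1 :=
    card_le_of_le_fwdDiff (x := j) hlam hD.le hd fun n hn ↦ by
      obtain ⟨hnS, hlt⟩ := mem_filter.1 hn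
      exact ⟨(hcover n hnS).1, (hcover n hnS).2.1, hlt.le⟩
  have hright : (#{n ∈ S | j + 1 - D < Δ_[1] f n} : ℝ) ≤ D / lam + 1 :=
    card_le_of_le_fwdDiff (x := j + 1 - D) hlam hD.le hd fun n hn ↦ by
      obtain ⟨hnS, hlt⟩ := mem_filter.1 hn
      exact ⟨(hcover n hnS).1, hlt.le, by linarith [(hcover n hnS).2.2]⟩
  have houter : (#{n ∈ S | Δ_[1] f n ∉ Set.Icc (j + D) (j + 1 - D)} : ℝ) ≤ 2 * (D / lam + 1) := by
    simp only [Set.mem_Icc, not_and_or, not_le, filter_or]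
    have := card_union_le {n ∈ S | Δ_[1] f n < j + D} {n ∈ S | j + 1 - D < Δ_[1] f n}
    rify at this
    linarith
  rw [← sum_filter_add_sum_filter_not S fun n ↦ Δ_[1] f n ∈ Set.Icc (j + D) (j + 1 - D), hinner]
  exact (norm_add_le _ _).trans (add_le_add (norm_sum_filter_fourierChar_le j hD hmono)
    ((norm_sum_fourierChar_le_card _ _).trans houter))

lemma norm_sum_fourierChar_le_of_fwdDiff_two {f : ℕ → ℝ} {M : ℕ} {lam A D : ℝ} (hlam : 0 < lam)
    (hD : 0 < D) (hA : 0 ≤ A) (hf : ∀ n < M, Δ_[1] ^[2] f n ∈ Set.Icc lam (A * lam)) :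
    ‖∑ n ∈ range M, (𝐞 (f n) : ℂ)‖ ≤ (A * lam * M + 2) * (1 / D + 2 * (D / lam + 1)) := by
  obtain _ | M := M
  · simp only [range_zero, sum_empty, norm_zero]
    positivity
  set d := Δ_[1] f
  have hmono : MonotoneOn d (Set.Iio (M + 1)) :=
    monotoneOn_of_le_add_one Set.ordConnected_Iio fun n _ hn _ ↦
      sub_nonneg.1 (hlam.le.trans (hf n hn).1)
  have hmaps : ∀ n ∈ range (M + 1), ⌊d n⌋ ∈ Icc ⌊d 0⌋ ⌊d M⌋ := fun n hn ↦ by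
    have hn := mem_range.1 hn
    exact mem_Icc.2 ⟨Int.floor_le_floor (hmono M.succ_pos hn n.zero_le),
      Int.floor_le_floor (hmono hn M.lt_succ_self (Nat.le_of_lt_succ hn))⟩
  have hcard : (#(Icc ⌊d 0⌋ ⌊d M⌋) : ℝ) ≤ A * lam * (M + 1 : ℕ) + 2 := by
    have hle := Int.floor_le_floor (hmono M.succ_pos M.lt_succ_self M.zero_le)
    have hrange : d M - d 0 ≤ A * lam * (M - (0 : ℕ)) :=
      (sub_mem_Icc_of_fwdDiff_mem_Icc M.zero_le fun n hn ↦ hf n (by grind)).2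
    rw [Int.card_Icc, ← Int.cast_natCast, Int.toNat_of_nonneg (by omega)]
    push_cast at hrange ⊢
    linarith [Int.floor_le (d M), Int.lt_floor_add_one (d 0), mul_nonneg hA hlam.le]
  rw [← sum_fiberwise_of_maps_to hmaps]
  refine (norm_sum_le_of_le _ fun j _ ↦ norm_sum_fourierChar_fiber_le j hlam hD
    (fun n hn ↦ (hf n (Nat.lt_of_succ_lt hn)).1) hmono).trans ?_
  rw [sum_const, nsmul_eq_mul]
  gcongr

/-! ### Van der Corput's inequality and the higher difference tests -/

lemma sum_range_ite_mem_Ico {K a b : ℕ} (hb : b ≤ K) (g : ℕ → ℂ) :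
    ∑ n ∈ range K, (if n ∈ Ico a b then g n else 0) = ∑ n ∈ range (b - a), g (a + n) := by
  rw [sum_ite_mem, inter_eq_right.2 fun n hn ↦ mem_range.2 ((mem_Ico.1 hn).2.trans_le hb),
    sum_Ico_eq_sum_range]

lemma sum_norm_sum_window_sq_le {z : ℕ → ℂ} {M H : ℕ} {B : ℝ} (hz : ∀ n, ‖z n‖ ≤ 1) (hB : 0 ≤ B)
    (hcor : ∀ h, 1 ≤ h → h < H → ‖∑ n ∈ range (M - h), z (n + h) * conj (z n)‖ ≤ B) :
    ∑ n ∈ range (M + H), ‖∑ r ∈ range H, if n ∈ Ico r (r + M) then z (n - r) else 0‖ ^ 2 ≤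
      M * H + B * H ^ 2 := by
  set Z : ℕ → ℕ → ℂ := fun r n ↦ if n ∈ Ico r (r + M) then z (n - r) else 0 with hZ
  have hdiag (r : ℕ) (_ : r ∈ range H) :
      ∑ n ∈ range (M + H), (1 : ℝ) * ‖Z r n‖ ^ 2 ≤ M * (1 : ℝ) ^ 2 := by
    have hle (n : ℕ) : (1 : ℝ) * ‖Z r n‖ ^ 2 ≤ if n ∈ Ico r (r + M) then 1 else 0 := by
      simp only [hZ]
      split_ifs
      · rw [one_mul]
        exact pow_le_one₀ (norm_nonneg _) (hz (n - r))
      · simp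
    refine (sum_le_sum fun n _ ↦ hle n).trans ?_
    rw [sum_ite_mem, sum_const, nsmul_one, one_pow, mul_one]
    exact_mod_cast (card_le_card inter_subset_right).trans (by simp)
  have hoff : ∀ r ∈ range H, ∀ s ∈ range H, r < s →
      ‖∑ n ∈ range (M + H), ((1 : ℝ) : ℂ) * (Z r n * conj (Z s n))‖ ≤ B * (1 * 1) := by
    intro r _ s hs hrs
    have hs := mem_range.1 hs
    have hprod (n : ℕ) : ((1 : ℝ) : ℂ) * (Z r n * conj (Z s n)) =
        if n ∈ Ico s (r + M) then z (n - r) * conj (z (n - s)) else 0 := by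
      simp only [hZ, mem_Ico, Complex.ofReal_one, one_mul]
      split_ifs <;> first | rfl | omega | simp
    rw [sum_congr rfl fun n _ ↦ hprod n, sum_range_ite_mem_Ico (by omega), mul_one, mul_one,
      show r + M - s = M - (s - r) by omega]
    refine (congrArg norm (sum_congr rfl fun n _ ↦ ?_)).trans_le
      (hcor (s - r) (by omega) (by omega))
    rw [show s + n - r = n + (s - r) by omega, add_tsub_cancel_left]
  simpa only [one_mul, one_pow, sum_const, card_range, nsmul_one] using
    sum_mul_norm_sum_sq_le hB hdiag hoff

/-- Van der Corput's inequality: average over `H` shifts of the sequence, and bound the mean square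
of the average. -/
lemma norm_sum_sq_le_of_correlation_le {z : ℕ → ℂ} {M H : ℕ} {B : ℝ} (hH : 0 < H)
    (hz : ∀ n, ‖z n‖ ≤ 1) (hB : 0 ≤ B)
    (hcor : ∀ h, 1 ≤ h → h < H → ‖∑ n ∈ range (M - h), z (n + h) * conj (z n)‖ ≤ B) :
    ‖∑ n ∈ range M, z n‖ ^ 2 ≤ (M + H) * (M / H + B) := by
  set Z : ℕ → ℕ → ℂ := fun r n ↦ if n ∈ Ico r (r + M) then z (n - r) else 0 with hZ
  have hshift (r : ℕ) (hr : r ∈ range H) : ∑ n ∈ range (M + H), Z r n = ∑ n ∈ range M, z n := by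
    have := mem_range.1 hr
    simp only [hZ]
    rw [sum_range_ite_mem_Ico (by omega)]
    simp only [add_tsub_cancel_left]
  have hsum : (H : ℂ) * ∑ n ∈ range M, z n = ∑ n ∈ range (M + H), ∑ r ∈ range H, Z r n := by
    rw [sum_comm, sum_congr rfl hshift, sum_const, card_range, nsmul_eq_mul]
  have hcauchy : ((H : ℝ) * ‖∑ n ∈ range M, z n‖) ^ 2 ≤
      (M + H) * ∑ n ∈ range (M + H), ‖∑ r ∈ range H, Z r n‖ ^ 2 := by
    have hnorm : (H : ℝ) * ‖∑ n ∈ range M, z n‖ = ‖∑ n ∈ range (M + H), ∑ r ∈ range H, Z r n‖ := by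
      rw [← hsum, norm_mul, Complex.norm_natCast]
    have hcs := sq_sum_le_card_mul_sum_sq (s := range (M + H))
      (f := fun n ↦ ‖∑ r ∈ range H, Z r n‖)
    rw [card_range, Nat.cast_add] at hcs
    rw [hnorm]
    exact (pow_le_pow_left₀ (norm_nonneg _) (norm_sum_le _ _) 2).trans hcs
  have hH₀ : (0 : ℝ) < H := by exact_mod_cast hH
  refine le_of_mul_le_mul_left ?_ (pow_pos hH₀ 2)
  calc (H : ℝ) ^ 2 * ‖∑ n ∈ range M, z n‖ ^ 2 = (H * ‖∑ n ∈ range M, z n‖) ^ 2 := by ring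
    _ ≤ (M + H) * (M * H + B * H ^ 2) := hcauchy.trans
      (mul_le_mul_of_nonneg_left (sum_norm_sum_window_sq_le hz hB hcor) (by positivity))
    _ = H ^ 2 * ((M + H) * (M / H + B)) := by field_simp

lemma iterate_fwdDiff_fwdDiff_mem_Icc {f : ℕ → ℝ} {k h n : ℕ} {L U : ℝ}
    (hf : ∀ i < h, Δ_[1] ^[k + 1] f (n + i) ∈ Set.Icc L U) :
    Δ_[1] ^[k] (Δ_[h] f) n ∈ Set.Icc (L * h) (U * h) := by
  have hcomm : Function.Commute (fwdDiff 1 : (ℕ → ℝ) → ℕ → ℝ) (fwdDiff h) := fun f ↦ by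
    ext m
    simp only [fwdDiff, add_right_comm m 1 h]
    ring
  have hsub := sub_mem_Icc_of_fwdDiff_mem_Icc (g := Δ_[1] ^[k] f) (n.le_add_right h) (L := L)
    (U := U) fun m hm ↦ by
      obtain ⟨i, rfl⟩ := Nat.exists_eq_add_of_le (mem_Ico.1 hm).1
      rw [← Function.iterate_succ_apply' (fwdDiff 1)]
      exact hf i (by grind)
  rw [(hcomm.iterate_left k).eq f]
  simpa [fwdDiff] using hsub

/-- The `k`-th difference test with exponent `a` and constant `C`: a sum of at most `N` phases
whose `k`-th differences lie in `[lam, A * lam]` is at most `C N (lam ^ a + (N ^ 2 lam) ^ (-a))`. -/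
def DifferenceTest (k : ℕ) (A C a : ℝ) : Prop :=
  ∀ (N lam : ℝ) (M : ℕ) (f : ℕ → ℝ), 1 ≤ N → M ≤ N → 0 < lam →
    (∀ n < M, Δ_[1] ^[k] f n ∈ Set.Icc lam (A * lam)) →
    ‖∑ n ∈ range M, (𝐞 (f n) : ℂ)‖ ≤ C * N * (lam ^ a + (N ^ 2 * lam) ^ (-a))

namespace DifferenceTest

lemma of_lt_one {k : ℕ} {A C a : ℝ} (hC : 1 ≤ C) (ha : 0 ≤ a)
    (h : ∀ (N lam : ℝ) (M : ℕ) (f : ℕ → ℝ), 1 ≤ N → M ≤ N → 0 < lam → lam < 1 → 1 < N ^ 2 * lam →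
      (∀ n < M, Δ_[1] ^[k] f n ∈ Set.Icc lam (A * lam)) →
      ‖∑ n ∈ range M, (𝐞 (f n) : ℂ)‖ ≤ C * N * (lam ^ a + (N ^ 2 * lam) ^ (-a))) :
    DifferenceTest k A C a := by
  intro N lam M f hN hM hlam hf
  have htrivial (h₁ : 1 ≤ lam ^ a + (N ^ 2 * lam) ^ (-a)) :
      ‖∑ n ∈ range M, (𝐞 (f n) : ℂ)‖ ≤ C * N * (lam ^ a + (N ^ 2 * lam) ^ (-a)) := by
    refine (norm_sum_fourierChar_le_card _ f).trans ?_
    rw [card_range]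
    exact hM.trans ((le_mul_of_one_le_left (by positivity) hC).trans
      (le_mul_of_one_le_right (by positivity) h₁))
  rcases le_or_gt 1 lam with hlam₁ | hlam₁
  · exact htrivial (le_add_of_le_of_nonneg (one_le_rpow hlam₁ ha) (by positivity))
  rcases le_or_gt (N ^ 2 * lam) 1 with hW | hW
  · exact htrivial (le_add_of_nonneg_of_le (by positivity)
      (one_le_rpow_of_pos_of_le_one_of_nonpos (by positivity) hW (neg_nonpos.2 ha)))
  · exact h N lam M f hN hM hlam hlam₁ hW hf

lemma two {A : ℝ} (hA : 0 ≤ A) : DifferenceTest 2 A (5 * A + 10) (1 / 2) := by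
  refine of_lt_one (by linarith) (by norm_num) fun N lam M f hN hM hlam hlam₁ _ hf ↦ ?_
  have hN₀ : 0 < N := by linarith
  have hs : 0 < √lam := sqrt_pos.2 hlam
  have hs₁ : √lam ≤ 1 := sqrt_le_one.2 hlam₁.le
  have hss : √lam ^ 2 = lam := sq_sqrt hlam.le
  have hone : 1 ≤ 1 / √lam := (one_le_div hs).2 hs₁
  have hdiv : √lam / lam = 1 / √lam := by rw [← hss, sqrt_sq hs.le]; field_simp
  rw [rpow_neg (by positivity), ← sqrt_eq_rpow, ← sqrt_eq_rpow, sqrt_mul (by positivity),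
    sqrt_sq hN₀.le]
  calc ‖∑ n ∈ range M, (𝐞 (f n) : ℂ)‖
      ≤ (A * lam * M + 2) * (1 / √lam + 2 * (√lam / lam + 1)) :=
        norm_sum_fourierChar_le_of_fwdDiff_two hlam hs hA hf
    _ ≤ (A * lam * N + 2) * (5 * (1 / √lam)) := by
        rw [hdiv]
        gcongr
        linarith
    _ = 5 * A * N * √lam + 10 * (1 / √lam) := by
        nth_rw 1 [← hss]
        field_simp
        ring
    _ ≤ (5 * A + 10) * N * √lam + (5 * A + 10) * (1 / √lam) := by
        gcongr <;> linarith
    _ = (5 * A + 10) * N * (√lam + (N * √lam)⁻¹) := by field_simp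

lemma norm_sum_mul_conj_le {k h : ℕ} {A C a N lam : ℝ} {M : ℕ} {f : ℕ → ℝ}
    (hT : DifferenceTest k A C a) (hC : 0 ≤ C) (ha : 0 ≤ a) (ha₁ : a ≤ 1) (hN : 1 ≤ N)
    (hM : M ≤ N) (hlam : 0 < lam) (hh : 1 ≤ h) (hhR : h ≤ 2 * lam ^ (-(1 / 2) : ℝ))
    (hf : ∀ n < M, Δ_[1] ^[k + 1] f n ∈ Set.Icc lam (A * lam)) :
    ‖∑ n ∈ range (M - h), (𝐞 (f (n + h)) : ℂ) * conj (𝐞 (f n) : ℂ)‖ ≤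
      C * N * (2 * lam ^ (a / 2) + (N ^ 2 * lam) ^ (-a)) := by
  have hh₁ : (1 : ℝ) ≤ h := by exact_mod_cast hh
  have hMh : ((M - h : ℕ) : ℝ) ≤ N := (Nat.cast_le.2 (Nat.sub_le M h)).trans hM
  have hdiff : ∀ n < M - h, Δ_[1] ^[k] (Δ_[h] f) n ∈ Set.Icc (lam * h) (A * (lam * h)) := by
    intro n hn
    rw [← mul_assoc]
    exact iterate_fwdDiff_fwdDiff_mem_Icc fun i hi ↦ hf (n + i) (by omega)
  have hlamh : lam * h ≤ 2 * lam ^ (1 / 2 : ℝ) := calc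
    lam * h ≤ lam * (2 * lam ^ (-(1 / 2) : ℝ)) := by gcongr
    _ = 2 * (lam ^ (1 : ℝ) * lam ^ (-(1 / 2) : ℝ)) := by rw [rpow_one]; ring
    _ = 2 * lam ^ (1 / 2 : ℝ) := by rw [← rpow_add hlam]; norm_num
  have hpow : (lam * h) ^ a ≤ 2 * lam ^ (a / 2) := calc
    (lam * h) ^ a ≤ (2 * lam ^ (1 / 2 : ℝ)) ^ a :=
      rpow_le_rpow (by positivity) hlamh ha
    _ = 2 ^ a * lam ^ (a / 2) := by
      rw [mul_rpow zero_le_two (by positivity), ← rpow_mul hlam.le, one_div_mul_eq_div]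
    _ ≤ 2 * lam ^ (a / 2) := by
      gcongr
      exact rpow_le_self_of_one_le one_le_two ha₁
  simp only [← coe_fourierChar_sub]
  refine (hT N (lam * h) (M - h) (Δ_[h] f) hN hMh (by positivity) hdiff).trans ?_
  gcongr ?_ * (?_ + ?_)
  refine rpow_le_rpow_of_nonpos (by positivity) ?_ (neg_nonpos.2 ha)
  exact mul_le_mul_of_nonneg_left (le_mul_of_one_le_right hlam.le hh₁) (by positivity)

lemma succ {k : ℕ} {A C a : ℝ} (hT : DifferenceTest k A C a) (hC : 1 ≤ C) (ha : 0 ≤ a)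
    (ha₁ : a ≤ 1) : DifferenceTest (k + 1) A (3 * (1 + 2 * C)) (a / 4) := by
  refine of_lt_one (by linarith) (by linarith) fun N lam M f hN hM hlam hlam₁ hW hf ↦ ?_
  have hN₀ : 0 < N := by linarith
  set R := lam ^ (-(1 / 2) : ℝ) with hR
  have hR₁ : 1 ≤ R := one_le_rpow_of_pos_of_le_one_of_nonpos hlam hlam₁.le (by norm_num)
  have hRN : R ≤ N := by
    rw [hR, rpow_neg hlam.le, ← sqrt_eq_rpow, inv_le_iff_one_le_mul₀ (sqrt_pos.2 hlam)]
    nlinarith [sq_sqrt hlam.le, mul_pos hN₀ (sqrt_pos.2 hlam)]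
  set H := ⌈R⌉₊
  have hHR : R ≤ H := Nat.le_ceil R
  have hH₂ : (H : ℝ) ≤ 2 * R := by linarith [Nat.ceil_lt_add_one (zero_le_one.trans hR₁)]
  have hvdc := norm_sum_sq_le_of_correlation_le (z := fun n ↦ (𝐞 (f n) : ℂ)) (M := M) (H := H)
    (Nat.ceil_pos.2 (by linarith)) (fun n ↦ (Circle.norm_coe _).le) (by positivity)
    fun h hh hhH ↦ hT.norm_sum_mul_conj_le (by linarith) ha ha₁ hN hM hlam hh
      ((Nat.cast_le.2 hhH.le).trans hH₂) hf
  set p := lam ^ (a / 4)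
  set q := (N ^ 2 * lam) ^ (-(a / 4))
  have hp : lam ^ (a / 2) = p ^ 2 := by
    rw [← rpow_mul_natCast hlam.le]
    ring_nf
  have hq : (N ^ 2 * lam) ^ (-a) ≤ q ^ 2 := by
    rw [← rpow_mul_natCast (by positivity)]
    exact rpow_le_rpow_of_exponent_le hW.le (by push_cast; linarith)
  have hMH : M / H ≤ N * p ^ 2 := calc
    (M / H : ℝ) ≤ N / R := by gcongr
    _ = N * lam ^ (1 / 2 : ℝ) := by rw [hR, rpow_neg hlam.le, div_inv_eq_mul]
    _ ≤ N * p ^ 2 := by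
      rw [← hp]
      exact mul_le_mul_of_nonneg_left
        (rpow_le_rpow_of_exponent_ge hlam hlam₁.le (by linarith)) hN₀.le
  refine (sq_le_sq₀ (norm_nonneg _) (by positivity)).1 (hvdc.trans ?_)
  calc (M + H) * (M / H + C * N * (2 * lam ^ (a / 2) + (N ^ 2 * lam) ^ (-a)))
      ≤ 3 * N * (N * p ^ 2 + C * N * (2 * p ^ 2 + q ^ 2)) := by
        rw [hp]
        gcongr
        linarith
    _ ≤ 3 * (1 + 2 * C) * (N * (p + q)) ^ 2 := by
        have : 0 ≤ N ^ 2 * (3 * q ^ 2 + 3 * C * q ^ 2 + 6 * (p * q) + 12 * C * (p * q)) := by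
          positivity
        linarith
    _ ≤ (3 * (1 + 2 * C)) ^ 2 * (N * (p + q)) ^ 2 := by
        gcongr
        exact le_self_pow₀ (by linarith) two_ne_zero
    _ = (3 * (1 + 2 * C) * N * (p + q)) ^ 2 := by ring

theorem exists_add_two (k : ℕ) {A : ℝ} (hA : 0 ≤ A) :
    ∃ C a : ℝ, 1 ≤ C ∧ 0 < a ∧ a ≤ 1 ∧ DifferenceTest (k + 2) A C a := by
  induction k with
  | zero => exact ⟨5 * A + 10, 1 / 2, by linarith, by norm_num, by norm_num, two hA⟩
  | succ k ih =>
    obtain ⟨C, a, hC, ha, ha₁, hT⟩ := ih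
    exact ⟨3 * (1 + 2 * C), a / 4, by linarith, by positivity, by linarith,
      hT.succ hC ha.le ha₁⟩

end DifferenceTest

/-! ### Power saving for sums of `𝐞 (β * n ^ c)` -/

lemma hasDerivAt_iterate_fwdDiff_rpow (k : ℕ) (c : ℝ) {x : ℝ} (hx : 0 < x) :
    HasDerivAt (Δ_[1] ^[k] fun t : ℝ ↦ t ^ c)
      (c * Δ_[1] ^[k] (fun t : ℝ ↦ t ^ (c - 1)) x) x := by
  induction k generalizing x with
  | zero => simpa using hasDerivAt_rpow_const (Or.inl hx.ne')
  | succ k ih =>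
    simp only [Function.iterate_succ_apply', fwdDiff, mul_sub]
    exact ((ih (by linarith)).comp_add_const x 1).sub (ih hx)

lemma exists_iterate_fwdDiff_rpow_eq (k : ℕ) (c : ℝ) {x : ℝ} (hx : 0 < x) :
    ∃ ξ ∈ Set.Icc x (x + k), Δ_[1] ^[k] (fun t : ℝ ↦ t ^ c) x =
      (∏ i ∈ range k, (c - i)) * ξ ^ (c - k) := by
  induction k generalizing c x with
  | zero => exact ⟨x, by simp, by simp⟩
  | succ k ih =>
    obtain ⟨y, ⟨hxy, hyx⟩, hslope⟩ := exists_hasDerivAt_eq_slope (Δ_[1] ^[k] fun t : ℝ ↦ t ^ c)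
      (fun y ↦ c * Δ_[1] ^[k] (fun t : ℝ ↦ t ^ (c - 1)) y) (lt_add_one x)
      (fun y hy ↦ (hasDerivAt_iterate_fwdDiff_rpow k c
        (hx.trans_le hy.1)).continuousAt.continuousWithinAt)
      (fun y hy ↦ hasDerivAt_iterate_fwdDiff_rpow k c (hx.trans hy.1))
    obtain ⟨ξ, ⟨hyξ, hξy⟩, hξ⟩ := ih (c - 1) (hx.trans hxy)
    refine ⟨ξ, ⟨hxy.le.trans hyξ, by push_cast; linarith⟩, ?_⟩
    rw [add_sub_cancel_left, div_one, hξ] at hslope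
    rw [Function.iterate_succ_apply', fwdDiff, ← hslope, prod_range_succ']
    push_cast
    simp only [sub_sub, add_comm (1 : ℝ), sub_zero]
    ring

lemma iterate_fwdDiff_comp_natCast (g : ℝ → ℝ) (x : ℝ) (k n : ℕ) :
    Δ_[1] ^[k] (fun m : ℕ ↦ g (x + m)) n = Δ_[1] ^[k] g (x + n) := by
  simp only [fwdDiff_iter_eq_sum_shift, nsmul_one, Nat.cast_add, add_assoc, Nat.cast_id]

lemma rpow_mem_Icc_of_mem_Icc {t K : ℝ} (s : ℝ) (ht : t ∈ Set.Icc 1 K) :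
    t ^ s ∈ Set.Icc (K ^ |s|)⁻¹ (K ^ |s|) := by
  obtain ⟨ht₁, htK⟩ := ht
  have ht₀ : 0 < t := by linarith
  have hle (r : ℝ) : t ^ r ≤ K ^ |r| := (rpow_le_rpow_of_exponent_le ht₁ (le_abs_self r)).trans
    (rpow_le_rpow ht₀.le htK (abs_nonneg r))
  refine ⟨inv_le_of_inv_le₀ (rpow_pos_of_pos ht₀ s) ?_, hle s⟩
  simpa only [rpow_neg ht₀.le, abs_neg] using hle (-s)

/-- This is where the nonintegrality of `c` enters: it keeps the factor `∏ i < k, (c - i)` of the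
`k`-th derivative away from zero. -/
lemma exists_iterate_fwdDiff_rpow_eq_mul {c : ℝ} (hc : ∀ k : ℤ, c ≠ k) (k : ℕ) :
    ∃ q A : ℝ, q ≠ 0 ∧ 0 ≤ A ∧ ∀ Y x : ℝ, 1 ≤ Y → x ∈ Set.Icc Y (2 * Y) →
      ∃ s ∈ Set.Icc 1 A, Δ_[1] ^[k] (fun t : ℝ ↦ t ^ c) x = q * Y ^ (c - k) * s := by
  set P := ∏ i ∈ range k, (c - i)
  have hP : P ≠ 0 := prod_ne_zero_iff.2 fun i _ ↦ sub_ne_zero.2 (by exact_mod_cast hc i)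
  set T : ℝ := ((k : ℝ) + 2) ^ |c - k|
  have hT : 0 < T := by positivity
  refine ⟨P / T, T * T, div_ne_zero hP hT.ne', by positivity, fun Y x hY ⟨hYx, hxY⟩ ↦ ?_⟩
  have hY₀ : 0 < Y := by linarith
  obtain ⟨ξ, ⟨hxξ, hξx⟩, hξ⟩ := exists_iterate_fwdDiff_rpow_eq k c (hY₀.trans_le hYx)
  have hratio : ξ / Y ∈ Set.Icc (1 : ℝ) (k + 2) := by
    refine ⟨(one_le_div hY₀).2 (hYx.trans hxξ), (div_le_iff₀ hY₀).2 ?_⟩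
    have : (k : ℝ) ≤ k * Y := le_mul_of_one_le_right k.cast_nonneg hY
    linarith
  obtain ⟨hlow, hupp⟩ := rpow_mem_Icc_of_mem_Icc (c - k) hratio
  refine ⟨T * (ξ / Y) ^ (c - k), ⟨?_, by gcongr⟩, ?_⟩
  · rwa [← inv_le_iff_one_le_mul₀' hT]
  · rw [hξ, div_rpow (by linarith) hY₀.le]
    field_simp
    exact mul_comm _ _

lemma norm_sum_fourierChar_mul_rpow_le {c q A C a β Y : ℝ} {k M : ℕ}
    (hT : DifferenceTest k A C a) (hY : 1 ≤ Y) (hM : M ≤ Y) (hβ : β * q ≠ 0)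
    (hdiff : ∀ x ∈ Set.Icc Y (2 * Y), ∃ s ∈ Set.Icc 1 A,
      Δ_[1] ^[k] (fun t : ℝ ↦ t ^ c) x = q * Y ^ (c - k) * s) :
    ‖∑ n ∈ range M, (𝐞 (β * (Y + n) ^ c) : ℂ)‖ ≤
      C * Y * ((|β * q| * Y ^ (c - k)) ^ a + (Y ^ 2 * (|β * q| * Y ^ (c - k))) ^ (-a)) := by
  wlog hpos : 0 < β * q generalizing β
  · have hneg := this (β := -β) (by simpa using hβ)
      (by rw [neg_mul]; exact neg_pos.2 (lt_of_le_of_ne (not_lt.1 hpos) hβ))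
    have hnorm := norm_sum_mul_fourierChar_neg (range M) (fun _ ↦ 1) fun n ↦ β * (Y + n) ^ c
    simp only [Complex.ofReal_one, one_mul] at hnorm
    simpa only [neg_mul, abs_neg, hnorm] using hneg
  refine hT Y _ M _ hY hM (by positivity) fun n hn ↦ ?_
  have hnM : (n : ℝ) ≤ M := by exact_mod_cast hn.le
  obtain ⟨s, ⟨hs₁, hsA⟩, hs⟩ := hdiff (Y + n) ⟨by simp, by linarith⟩
  have hval : Δ_[1] ^[k] (fun n : ℕ ↦ β * (Y + n) ^ c) n = s * (|β * q| * Y ^ (c - k)) := by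
    have hsmul := congrFun (fwdDiff_iter_const_smul (h := 1) β (fun n : ℕ ↦ (Y + n) ^ c) k) n
    rw [Pi.smul_apply, iterate_fwdDiff_comp_natCast (fun t ↦ t ^ c), hs] at hsmul
    rw [abs_of_pos hpos]
    refine hsmul.trans ?_
    rw [smul_eq_mul]
    ring
  rw [hval]
  exact ⟨le_mul_of_one_le_left (by positivity) hs₁, by gcongr⟩

lemma exists_norm_sum_fourierChar_mul_rpow_block_le {c : ℝ} (hc : ∀ k : ℤ, c ≠ k) (j : ℕ) :
    ∃ η C : ℝ, 0 < η ∧ η ≤ 1 / 2 ∧ 0 ≤ C ∧ ∀ (Y β : ℝ) (M : ℕ), 1 ≤ Y → M ≤ Y →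
      |β| * Y ^ c ∈ Set.Icc (Y ^ (j + 3 / 4 : ℝ)) (Y ^ (j + 7 / 4 : ℝ)) →
      ‖∑ n ∈ range M, (𝐞 (β * (Y + n) ^ c) : ℂ)‖ ≤ C * Y ^ (1 - η) := by
  obtain ⟨q, A, hq, hA, hdiff⟩ := exists_iterate_fwdDiff_rpow_eq_mul hc (j + 2)
  obtain ⟨C, a, hC, ha, ha₁, hT⟩ := DifferenceTest.exists_add_two j hA
  refine ⟨a / 4, C * (|q| ^ a + |q| ^ (-a)), by positivity, by linarith, by positivity,
    fun Y β M hY hM ⟨hlow, hupp⟩ ↦ ?_⟩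
  have hY₀ : 0 < Y := by linarith
  have hq₀ : 0 < |q| := abs_pos.2 hq
  have hβ : β ≠ 0 := by
    rintro rfl
    rw [abs_zero, zero_mul] at hlow
    exact absurd hlow (not_le.2 (by positivity))
  have hscale : |β * q| * Y ^ (c - (j + 2 : ℕ)) =
      |β| * Y ^ c * Y ^ (-(j + 2) : ℝ) * |q| := by
    rw [abs_mul, sub_eq_add_neg, rpow_add hY₀]
    push_cast
    ring
  have hlam : |β * q| * Y ^ (c - (j + 2 : ℕ)) ≤ Y ^ (-(1 / 4) : ℝ) * |q| := by
    rw [hscale, show (-(1 / 4) : ℝ) = j + 7 / 4 + -(j + 2) by ring, rpow_add hY₀]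
    gcongr
  have hlam' : Y ^ (1 / 4 : ℝ) * |q| ≤ Y ^ 2 * (|β * q| * Y ^ (c - (j + 2 : ℕ))) := by
    have hsplit : Y ^ (3 / 4 : ℝ) = Y ^ 2 * (Y ^ (j + 3 / 4 : ℝ) * Y ^ (-(j + 2) : ℝ)) := by
      rw [← rpow_natCast, ← rpow_add hY₀, ← rpow_add hY₀]
      push_cast
      ring_nf
    calc Y ^ (1 / 4 : ℝ) * |q| ≤ Y ^ (3 / 4 : ℝ) * |q| := by
          gcongr
          norm_num
      _ ≤ Y ^ 2 * (|β| * Y ^ c * Y ^ (-(j + 2) : ℝ)) * |q| := by rw [hsplit]; gcongr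
      _ = Y ^ 2 * (|β * q| * Y ^ (c - (j + 2 : ℕ))) := by rw [hscale]; ring
  have hpow (e r : ℝ) (her : e * r = -(a / 4)) :
      (Y ^ e * |q|) ^ r = |q| ^ r * Y ^ (-(a / 4)) := by
    rw [mul_rpow (by positivity) hq₀.le, ← rpow_mul hY₀.le, her, mul_comm]
  calc ‖∑ n ∈ range M, (𝐞 (β * (Y + n) ^ c) : ℂ)‖
      ≤ C * Y * ((Y ^ (-(1 / 4) : ℝ) * |q|) ^ a + (Y ^ (1 / 4 : ℝ) * |q|) ^ (-a)) := by
        refine (norm_sum_fourierChar_mul_rpow_le hT hY hM (mul_ne_zero hβ hq)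
          fun x hx ↦ hdiff Y x hY hx).trans ?_
        gcongr ?_ * (?_ + ?_)
        · exact rpow_le_rpow (by positivity) hlam ha.le
        · exact rpow_le_rpow_of_nonpos (by positivity) hlam' (neg_nonpos.2 ha.le)
    _ = C * (|q| ^ a + |q| ^ (-a)) * Y ^ (1 - a / 4) := by
        rw [hpow _ _ (by ring), hpow _ _ (by ring), sub_eq_add_neg, rpow_add hY₀, rpow_one]
        ring

lemma exists_norm_sum_fourierChar_mul_rpow_le_of_mem_Icc {c : ℝ} (hc : ∀ k : ℤ, c ≠ k) (j : ℕ) :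
    ∃ η C : ℝ, 0 < η ∧ η ≤ 1 / 2 ∧ 0 ≤ C ∧ ∀ (Y β : ℝ) (M : ℕ), 1 ≤ Y → M ≤ Y →
      |β| * Y ^ c ∈ Set.Icc (Y ^ (3 / 4 : ℝ)) (Y ^ (j + 7 / 4 : ℝ)) →
      ‖∑ n ∈ range M, (𝐞 (β * (Y + n) ^ c) : ℂ)‖ ≤ C * Y ^ (1 - η) := by
  induction j with
  | zero => simpa using exists_norm_sum_fourierChar_mul_rpow_block_le hc 0
  | succ j ih =>
    obtain ⟨η, C, hη, hη₁, hC, hsmall⟩ := ih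
    obtain ⟨η', C', hη', -, -, hlarge⟩ := exists_norm_sum_fourierChar_mul_rpow_block_le hc (j + 1)
    refine ⟨min η η', max C C', lt_min hη hη', (min_le_left _ _).trans hη₁,
      hC.trans (le_max_left _ _), fun Y β M hY hM ⟨hlow, hupp⟩ ↦ ?_⟩
    rcases le_total (|β| * Y ^ c) (Y ^ (j + 7 / 4 : ℝ)) with hle | hle
    · refine (hsmall Y β M hY hM ⟨hlow, hle⟩).trans ?_
      gcongr
      exacts [le_max_left _ _, min_le_left _ _]
    · refine (hlarge Y β M hY hM ⟨?_, hupp⟩).trans ?_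
      · convert hle using 2
        push_cast
        ring
      · gcongr
        exacts [le_max_right _ _, min_le_right _ _]

lemma norm_sum_Ioc_le_of_half_block {u : ℕ → ℂ} {R C η : ℝ} (hu : ∀ n, ‖u n‖ ≤ 1) (hR : 1 ≤ R)
    (hC : 0 ≤ C) (hη : η ≤ 1 / 2)
    (hblock : ∀ Y : ℕ, R ≤ (Y / 2 : ℕ) → ‖∑ n ∈ Ioc (Y / 2) Y, u n‖ ≤ C * Y ^ (1 - η)) (Y : ℕ) :
    ‖∑ n ∈ Ioc 0 Y, u n‖ ≤ 3 * R + 4 * C * Y ^ (1 - η) := by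
  induction Y using Nat.strong_induction_on with
  | _ Y ih =>
    rcases lt_or_ge ((Y / 2 : ℕ) : ℝ) R with hlt | hge
    · have htrivial : ‖∑ n ∈ Ioc 0 Y, u n‖ ≤ Y := by
        simpa using norm_sum_le_of_le (Ioc 0 Y) fun n _ ↦ hu n
      have hYR : (Y : ℝ) ≤ 2 * (Y / 2 : ℕ) + 1 := by
        exact_mod_cast (show Y ≤ 2 * (Y / 2) + 1 by omega)
      linarith [show 0 ≤ 4 * C * (Y : ℝ) ^ (1 - η) by positivity]
    · have hpos : 0 < Y / 2 := by exact_mod_cast one_pos.trans_le (hR.trans hge)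
      have hhalf : (1.4 : ℝ) * ((Y / 2 : ℕ) : ℝ) ^ (1 - η) ≤ (Y : ℝ) ^ (1 - η) := calc
        (1.4 : ℝ) * ((Y / 2 : ℕ) : ℝ) ^ (1 - η) ≤ 2 ^ (1 - η) * ((Y / 2 : ℕ) : ℝ) ^ (1 - η) := by
          gcongr
          calc (1.4 : ℝ) ≤ √2 := le_sqrt_of_sq_le (by norm_num)
            _ = 2 ^ (1 / 2 : ℝ) := sqrt_eq_rpow 2
            _ ≤ 2 ^ (1 - η) := rpow_le_rpow_of_exponent_le one_le_two (by linarith)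
        _ = (2 * (Y / 2 : ℕ) : ℝ) ^ (1 - η) := (mul_rpow zero_le_two (Nat.cast_nonneg _)).symm
        _ ≤ (Y : ℝ) ^ (1 - η) := by
          gcongr
          · linarith
          · exact_mod_cast Nat.mul_div_le Y 2
      rw [← sum_Ioc_consecutive u (Nat.zero_le _) (Nat.div_le_self Y 2)]
      refine (norm_add_le _ _).trans
        ((add_le_add (ih (Y / 2) (by omega)) (hblock Y hge)).trans ?_)
      linarith [mul_le_mul_of_nonneg_left hhalf hC,
        show 0 ≤ C * (Y : ℝ) ^ (1 - η) by positivity]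

lemma mul_rpow_mem_Icc_of_sqrt_le {c B J X W b : ℝ} (hc : 1 < c) (hJ : 2 * |B| + c ≤ J)
    (hX : 1 ≤ X) (hW : X ^ (1 / 2 : ℝ) ≤ W) (hb : b ∈ Set.Icc (X ^ (-((c - 1) / 2))) (X ^ B)) :
    b * W ^ c ∈ Set.Icc (W ^ (3 / 4 : ℝ)) (W ^ (J + 7 / 4)) := by
  obtain ⟨hlow, hupp⟩ := hb
  have hX₀ : 0 < X := by linarith
  have hW₁ : 1 ≤ W := (one_le_rpow hX (by norm_num)).trans hW
  have hW₀ : 0 < W := by linarith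
  have hXW : X ≤ W ^ (2 : ℝ) := calc
    X = (X ^ (1 / 2 : ℝ)) ^ (2 : ℝ) := by rw [← rpow_mul hX₀.le]; norm_num
    _ ≤ W ^ (2 : ℝ) := by gcongr
  constructor
  · calc W ^ (3 / 4 : ℝ) ≤ W ^ (1 : ℝ) := rpow_le_rpow_of_exponent_le hW₁ (by norm_num)
      _ = (W ^ (2 : ℝ)) ^ (-((c - 1) / 2)) * W ^ c := by
          rw [← rpow_mul hW₀.le, ← rpow_add hW₀]
          ring_nf
      _ ≤ X ^ (-((c - 1) / 2)) * W ^ c := by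
          gcongr ?_ * _
          exact rpow_le_rpow_of_nonpos hX₀ hXW (by linarith)
      _ ≤ b * W ^ c := by gcongr
  · calc b * W ^ c ≤ (W ^ (2 : ℝ)) ^ |B| * W ^ c := by
          gcongr
          exact hupp.trans ((rpow_le_rpow_of_exponent_le hX (le_abs_self B)).trans
            (rpow_le_rpow hX₀.le hXW (abs_nonneg B)))
      _ = W ^ (2 * |B| + c) := by rw [← rpow_mul hW₀.le, ← rpow_add hW₀]
      _ ≤ W ^ (J + 7 / 4) := rpow_le_rpow_of_exponent_le hW₁ (by linarith)

theorem exists_norm_sum_fourierChar_mul_rpow_le {c : ℝ} (hc : 1 < c) (hcZ : ∀ k : ℤ, c ≠ k)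
    (B : ℝ) :
    ∃ η C : ℝ, 0 < η ∧ η ≤ 1 / 2 ∧ 0 ≤ C ∧ ∀ (X β : ℝ) (Y : ℕ), 1 ≤ X → Y ≤ X →
      X ^ (-((c - 1) / 2)) ≤ |β| → |β| ≤ X ^ B →
      ‖∑ n ∈ Ioc 0 Y, (𝐞 (β * (n : ℝ) ^ c) : ℂ)‖ ≤ C * X ^ (1 - η) := by
  obtain ⟨j, hj⟩ := exists_nat_ge (2 * |B| + c)
  obtain ⟨η, C, hη, hη₁, hC, hblock⟩ := exists_norm_sum_fourierChar_mul_rpow_le_of_mem_Icc hcZ j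
  refine ⟨η, 3 + 4 * C, hη, hη₁, by positivity, fun X β Y hX hYX hlow hupp ↦ ?_⟩
  have hglue := norm_sum_Ioc_le_of_half_block (u := fun n ↦ (𝐞 (β * (n : ℝ) ^ c) : ℂ))
    (fun n ↦ (Circle.norm_coe _).le) (one_le_rpow hX (by norm_num : (0 : ℝ) ≤ 1 / 2)) hC hη₁ ?_ Y
  · refine hglue.trans ?_
    rw [add_mul]
    gcongr <;> linarith
  intro W hW
  have hW₁ : (1 : ℝ) ≤ (W / 2 : ℕ) := (one_le_rpow hX (by norm_num)).trans hW
  have hshift : ∑ n ∈ Ioc (W / 2) W, (𝐞 (β * (n : ℝ) ^ c) : ℂ) =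
      ∑ n ∈ range (W - W / 2), (𝐞 (β * ((W / 2 : ℕ) + 1 + n : ℝ) ^ c) : ℂ) := by
    rw [show Ioc (W / 2) W = Ico (W / 2 + 1) (W + 1) by grind, sum_Ico_eq_sum_range,
      Nat.add_sub_add_right]
    push_cast
    rfl
  have hM : ((W - W / 2 : ℕ) : ℝ) ≤ (W / 2 : ℕ) + 1 := by
    exact_mod_cast (show W - W / 2 ≤ W / 2 + 1 by omega)
  have hle : ((W / 2 : ℕ) : ℝ) + 1 ≤ W := by
    have : 1 ≤ W / 2 := by exact_mod_cast hW₁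
    exact_mod_cast (show W / 2 + 1 ≤ W by omega)
  rw [hshift]
  refine (hblock _ β _ (by linarith) hM
    (mul_rpow_mem_Icc_of_sqrt_le hc hj hX (by linarith) ⟨hlow, hupp⟩)).trans ?_
  gcongr
  linarith

/-! ### Divisor sums and partial summation -/

lemma sum_Ioc_sum_divisorsAntidiagonal {M : Type*} [AddCommMonoid M] (F : ℕ → ℕ → M) (N : ℕ) :
    ∑ n ∈ Ioc 0 N, ∑ x ∈ n.divisorsAntidiagonal, F x.1 x.2 =
      ∑ k ∈ Ioc 0 N, ∑ l ∈ Ioc 0 (N / k), F k l := by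
  rw [sum_sigma', sum_sigma']
  refine sum_nbij' (fun x ↦ ⟨x.2.1, x.2.2⟩) (fun x ↦ ⟨x.1 * x.2, (x.1, x.2)⟩) ?_ ?_ ?_ ?_ ?_
  · rintro ⟨n, k, l⟩ h
    obtain ⟨⟨hn, hnN⟩, rfl, -⟩ := by
      simpa only [mem_sigma, mem_Ioc, Nat.mem_divisorsAntidiagonal] using h
    have hk : 0 < k := Nat.pos_of_mul_pos_right hn
    simp only [mem_sigma, mem_Ioc, Nat.le_div_iff_mul_le hk]
    exact ⟨⟨hk, (Nat.le_mul_of_pos_right k (Nat.pos_of_mul_pos_left hn)).trans hnN⟩,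
      Nat.pos_of_mul_pos_left hn, by rwa [mul_comm]⟩
  · rintro ⟨k, l⟩ h
    obtain ⟨⟨hk, -⟩, hl, hlN⟩ := by simpa only [mem_sigma, mem_Ioc] using h
    rw [Nat.le_div_iff_mul_le hk, mul_comm] at hlN
    simp only [mem_sigma, mem_Ioc, Nat.mem_divisorsAntidiagonal]
    exact ⟨⟨mul_pos hk hl, hlN⟩, trivial, (mul_pos hk hl).ne'⟩
  · rintro ⟨n, k, l⟩ h
    obtain ⟨-, rfl, -⟩ := by
      simpa only [mem_sigma, mem_Ioc, Nat.mem_divisorsAntidiagonal] using h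
    rfl
  · exact fun _ _ ↦ rfl
  · exact fun _ _ ↦ rfl

lemma sum_Ioc_mul_apply_mul (f g : ArithmeticFunction ℝ) (z : ℕ → ℂ) (N : ℕ) :
    ∑ n ∈ Ioc 0 N, ((f * g) n : ℂ) * z n =
      ∑ k ∈ Ioc 0 N, (f k : ℂ) * ∑ l ∈ Ioc 0 (N / k), (g l : ℂ) * z (k * l) := by
  simp only [mul_sum]
  rw [← sum_Ioc_sum_divisorsAntidiagonal fun k l ↦ (f k : ℂ) * (g l * z (k * l))]
  refine sum_congr rfl fun n _ ↦ ?_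
  rw [ArithmeticFunction.mul_apply, Complex.ofReal_sum, sum_mul]
  refine sum_congr rfl fun x hx ↦ ?_
  rw [(Nat.mem_divisorsAntidiagonal.1 hx).1, Complex.ofReal_mul, mul_assoc]

lemma log_natCast_le_log_natCast {k N : ℕ} (h : k ≤ N) : Real.log k ≤ Real.log N := by
  rcases k.eq_zero_or_pos with rfl | hk
  · simpa using Real.log_natCast_nonneg N
  · exact Real.log_le_log (by exact_mod_cast hk) (by exact_mod_cast h)

lemma sum_Ioc_inv_le_one_add_log (N : ℕ) : ∑ k ∈ Ioc 0 N, (k : ℝ)⁻¹ ≤ 1 + Real.log N := by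
  have h := harmonic_le_one_add_log N
  rw [harmonic_eq_sum_Icc] at h
  push_cast at h
  exact h

lemma sum_card_divisors_le (N : ℕ) :
    ∑ k ∈ Ioc 0 N, (#k.divisors : ℝ) ≤ N * (1 + Real.log N) := by
  have h := ArithmeticFunction.sum_Ioc_sigma0_eq_sum_div N
  simp only [ArithmeticFunction.sigma_zero_apply] at h
  calc ∑ k ∈ Ioc 0 N, (#k.divisors : ℝ) = ∑ k ∈ Ioc 0 N, ((N / k : ℕ) : ℝ) := by exact_mod_cast h
    _ ≤ ∑ k ∈ Ioc 0 N, N * (k : ℝ)⁻¹ := sum_le_sum fun k _ ↦ Nat.cast_div_le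
    _ ≤ N * (1 + Real.log N) := by
      rw [← mul_sum]
      exact mul_le_mul_of_nonneg_left (sum_Ioc_inv_le_one_add_log N) N.cast_nonneg

lemma card_divisors_le_two_mul_sqrt (k : ℕ) : (#k.divisors : ℝ) ≤ 2 * √k := by
  have hsub : k.divisors ⊆ Icc 1 k.sqrt ∪ (Icc 1 k.sqrt).image (k / ·) := by
    intro d hd
    obtain ⟨hdk, hk⟩ := Nat.mem_divisors.1 hd
    have hd₀ := Nat.pos_of_mem_divisors hd
    rw [mem_union, mem_image]
    refine (le_or_gt d k.sqrt).imp (fun h ↦ mem_Icc.2 ⟨hd₀, h⟩) fun h ↦ ?_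
    refine ⟨k / d, mem_Icc.2 ⟨Nat.div_pos (Nat.divisor_le hd) hd₀, ?_⟩, Nat.div_div_self hdk hk⟩
    rw [← Nat.lt_succ_iff, Nat.div_lt_iff_lt_mul hd₀]
    exact (Nat.lt_succ_sqrt k).trans_le (Nat.mul_le_mul_left _ h)
  have hcard : #k.divisors ≤ 2 * k.sqrt := by
    refine (card_le_card hsub).trans ((card_union_le _ _).trans ?_)
    rw [two_mul]
    exact add_le_add (by simp) (card_image_le.trans (by simp))
  have hcard' : (#k.divisors : ℝ) ≤ 2 * k.sqrt := by exact_mod_cast hcard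
  exact hcard'.trans (by gcongr; exact Real.nat_sqrt_le_real_sqrt)

lemma sum_Ioc_vonMangoldt_le (N : ℕ) : ∑ n ∈ Ioc 0 N, Λ n ≤ 6 * N := by
  have hpsi := Chebyshev.psi_le_const_mul_self (x := N) N.cast_nonneg
  rw [Chebyshev.psi, Nat.floor_natCast] at hpsi
  refine hpsi.trans (mul_le_mul_of_nonneg_right ?_ N.cast_nonneg)
  rw [show (4 : ℝ) = 2 ^ 2 by norm_num, Real.log_pow]
  push_cast
  linarith [Real.log_two_lt_d9]

lemma norm_sum_vonMangoldt_mul_le {z : ℕ → ℂ} (hz : ∀ n, ‖z n‖ ≤ 1) (N : ℕ) :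
    ‖∑ n ∈ Ioc 0 N, (Λ n : ℂ) * z n‖ ≤ 6 * N := by
  refine (norm_sum_le_of_le _ fun n _ ↦ ?_).trans (sum_Ioc_vonMangoldt_le N)
  rw [norm_mul, Complex.norm_real, norm_of_nonneg ArithmeticFunction.vonMangoldt_nonneg]
  exact mul_le_of_le_one_right ArithmeticFunction.vonMangoldt_nonneg (hz n)

lemma sum_Ioc_mul_eq_sub_sum_range {R : Type*} [CommRing R] (w u : ℕ → R) (M : ℕ) :
    ∑ n ∈ Ioc 0 M, w n * u n = w M * ∑ n ∈ Ioc 0 M, u n -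
      ∑ n ∈ range M, (w (n + 1) - w n) * ∑ i ∈ Ioc 0 n, u i := by
  induction M with
  | zero => simp
  | succ M ih =>
    rw [sum_Ioc_succ_top M.zero_le, sum_Ioc_succ_top M.zero_le, sum_range_succ, ih]
    ring

lemma norm_sum_Ioc_monotone_mul_le {w : ℕ → ℝ} {u : ℕ → ℂ} {M : ℕ} {G : ℝ} (hw : Monotone w)
    (hw₀ : 0 ≤ w 0) (hu : ∀ Y ≤ M, ‖∑ n ∈ Ioc 0 Y, u n‖ ≤ G) :
    ‖∑ n ∈ Ioc 0 M, (w n : ℂ) * u n‖ ≤ 2 * G * w M := by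
  have hG : 0 ≤ G := (norm_nonneg _).trans (hu 0 M.zero_le)
  have hscale (r : ℝ) (hr : 0 ≤ r) (Y : ℕ) (hY : Y ≤ M) :
      ‖(r : ℂ) * ∑ n ∈ Ioc 0 Y, u n‖ ≤ r * G := by
    rw [norm_mul, Complex.norm_real, norm_of_nonneg hr]
    exact mul_le_mul_of_nonneg_left (hu Y hY) hr
  have hend := hscale (w M) (hw₀.trans (hw M.zero_le)) M le_rfl
  have hdiff : ‖∑ n ∈ range M, ((w (n + 1) - w n : ℝ) : ℂ) * ∑ i ∈ Ioc 0 n, u i‖ ≤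
      (w M - w 0) * G := by
    rw [← sum_range_sub, sum_mul]
    exact norm_sum_le_of_le _ fun n hn ↦
      hscale _ (sub_nonneg.2 (hw n.le_succ)) n (mem_range.1 hn).le
  rw [sum_Ioc_mul_eq_sub_sum_range fun n ↦ (w n : ℂ)]
  push_cast at hdiff
  refine (norm_sub_le _ _).trans ((add_le_add hend hdiff).trans ?_)
  linarith [mul_nonneg hw₀ hG]

/-! ### Vaughan's identity -/

/-- The restriction of `f` to arguments at most `V`, extended by zero. -/
def lowPart (V : ℕ) (f : ArithmeticFunction ℝ) : ArithmeticFunction ℝ :=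
  ⟨fun n ↦ if n ≤ V then f n else 0, by simp⟩

/-- The restriction of `f` to arguments greater than `V`, extended by zero. -/
def highPart (V : ℕ) (f : ArithmeticFunction ℝ) : ArithmeticFunction ℝ :=
  ⟨fun n ↦ if n ≤ V then 0 else f n, by simp⟩

lemma lowPart_apply (V : ℕ) (f : ArithmeticFunction ℝ) (n : ℕ) :
    lowPart V f n = if n ≤ V then f n else 0 := rfl

lemma highPart_apply (V : ℕ) (f : ArithmeticFunction ℝ) (n : ℕ) :
    highPart V f n = if n ≤ V then 0 else f n := rfl

lemma lowPart_add_highPart (V : ℕ) (f : ArithmeticFunction ℝ) :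
    lowPart V f + highPart V f = f := by
  ext n
  rw [ArithmeticFunction.add_apply, lowPart_apply, highPart_apply]
  split_ifs <;> simp

lemma vonMangoldt_add_lowPart_mul (V : ℕ) :
    Λ + lowPart V μ * lowPart V Λ * ζ =
      lowPart V Λ + lowPart V μ * ArithmeticFunction.log + highPart V μ * ζ * highPart V Λ := by
  have hμζ : (lowPart V μ + highPart V μ) * (ζ : ArithmeticFunction ℝ) = 1 := by
    rw [lowPart_add_highPart, ArithmeticFunction.coe_moebius_mul_coe_zeta]
  have hlog := ArithmeticFunction.vonMangoldt_mul_zeta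
  have hΛ := lowPart_add_highPart V Λ
  linear_combination (-highPart V Λ) * hμζ + lowPart V μ * hlog + (lowPart V μ * ζ - 1) * hΛ

lemma abs_lowPart_le (V : ℕ) (f : ArithmeticFunction ℝ) (n : ℕ) : |lowPart V f n| ≤ |f n| := by
  rw [lowPart_apply]
  split_ifs <;> simp

lemma abs_highPart_le (V : ℕ) (f : ArithmeticFunction ℝ) (n : ℕ) : |highPart V f n| ≤ |f n| := by
  rw [highPart_apply]
  split_ifs <;> simp

lemma abs_moebius_real_le_one (n : ℕ) : |(μ : ArithmeticFunction ℝ) n| ≤ 1 := by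
  rw [ArithmeticFunction.intCoe_apply]
  exact_mod_cast ArithmeticFunction.abs_moebius_le_one

lemma abs_highPart_moebius_mul_zeta_le (V k : ℕ) :
    |(highPart V μ * ζ : ArithmeticFunction ℝ) k| ≤ #k.divisors := by
  rw [ArithmeticFunction.coe_mul_zeta_apply, card_eq_sum_ones, Nat.cast_sum, Nat.cast_one]
  exact (abs_sum_le_sum_abs _ _).trans
    (sum_le_sum fun d _ ↦ (abs_highPart_le V μ d).trans (abs_moebius_real_le_one d))

lemma highPart_mul_zeta_eq_zero {V k : ℕ} (f : ArithmeticFunction ℝ) (h : k ≤ V) :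
    (highPart V f * ζ : ArithmeticFunction ℝ) k = 0 := by
  rw [ArithmeticFunction.coe_mul_zeta_apply]
  exact sum_eq_zero fun d hd ↦ if_pos ((Nat.divisor_le hd).trans h)

lemma abs_lowPart_moebius_mul_lowPart_vonMangoldt_le (V k : ℕ) :
    |(lowPart V μ * lowPart V Λ) k| ≤ Real.log k := by
  rw [ArithmeticFunction.mul_apply, ← ArithmeticFunction.vonMangoldt_sum,
    ← Nat.sum_divisorsAntidiagonal' (f := fun _ e ↦ Λ e)]
  refine (abs_sum_le_sum_abs _ _).trans (sum_le_sum fun x _ ↦ ?_)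
  have hΛ := abs_lowPart_le V Λ x.2
  rw [abs_of_nonneg (a := Λ x.2) ArithmeticFunction.vonMangoldt_nonneg] at hΛ
  rw [abs_mul, ← one_mul (Λ x.2)]
  exact mul_le_mul ((abs_lowPart_le V μ _).trans (abs_moebius_real_le_one _)) hΛ
    (abs_nonneg _) zero_le_one

lemma lowPart_mul_lowPart_eq_zero {V k : ℕ} (f g : ArithmeticFunction ℝ) (h : V * V < k) :
    (lowPart V f * lowPart V g) k = 0 := by
  rw [ArithmeticFunction.mul_apply]
  refine sum_eq_zero fun x hx ↦ ?_
  rw [← (Nat.mem_divisorsAntidiagonal.1 hx).1] at h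
  rw [lowPart_apply, lowPart_apply, mul_eq_zero, ite_eq_right_iff, ite_eq_right_iff]
  by_contra! hne
  exact absurd (Nat.mul_le_mul hne.1.1 hne.2.1) (not_le.2 h)

/-! ### Type I and type II sums -/

lemma norm_sum_mul_le_of_norm_le_div {V N : ℕ} {A G : ℝ} {a : ℕ → ℝ} {S : ℕ → ℂ} (hA : 0 ≤ A)
    (hG : 0 ≤ G) (ha : ∀ k ≤ N, |a k| ≤ A) (ha₀ : ∀ k, V < k → a k = 0)
    (hS : ∀ k, 0 < k → k ≤ V → ‖S k‖ ≤ G * (N / k)) :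
    ‖∑ k ∈ Ioc 0 N, (a k : ℂ) * S k‖ ≤ A * G * N * (1 + Real.log N) := by
  have hterm : ∀ k ∈ Ioc 0 N, ‖(a k : ℂ) * S k‖ ≤ A * G * N * (k : ℝ)⁻¹ := by
    intro k hk
    obtain ⟨hk₀, hkN⟩ := mem_Ioc.1 hk
    rw [norm_mul, Complex.norm_real, norm_eq_abs]
    rcases le_or_gt k V with hkV | hkV
    · calc |a k| * ‖S k‖ ≤ A * (G * (N / k)) :=
            mul_le_mul (ha k hkN) (hS k hk₀ hkV) (norm_nonneg _) hA
        _ = A * G * N * (k : ℝ)⁻¹ := by ring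
    · rw [ha₀ k hkV, abs_zero, zero_mul]
      positivity
  refine (norm_sum_le_of_le _ hterm).trans ?_
  rw [← mul_sum]
  exact mul_le_mul_of_nonneg_left (sum_Ioc_inv_le_one_add_log N) (by positivity)

lemma sum_Ioc_sum_Ioc_div_comm {K K' N : ℕ} (hK : 0 < K) (F : ℕ → ℕ → ℂ) :
    ∑ k ∈ Ioc K K', ∑ l ∈ Ioc 0 (N / k), F k l =
      ∑ l ∈ Ioc 0 (N / K), ∑ k ∈ Ioc K K', if l ∈ Ioc 0 (N / k) then F k l else 0 := by
  rw [sum_comm]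
  refine sum_congr rfl fun k hk ↦ ?_
  rw [sum_ite_mem, inter_eq_right.2]
  exact Ioc_subset_Ioc_right (Nat.div_le_div_left (mem_Ioc.1 hk).1.le hK)

lemma sum_Ioc_div_le_mul {K N : ℕ} {f : ℕ → ℝ} {M : ℝ} (hM : 0 ≤ M)
    (hf : ∀ l ∈ Ioc 0 (N / K), f l ≤ M) : ∑ l ∈ Ioc 0 (N / K), f l ≤ N / K * M := by
  refine (sum_le_card_nsmul _ _ _ hf).trans ?_
  rw [Nat.card_Ioc, Nat.sub_zero, nsmul_eq_mul]
  exact mul_le_mul_of_nonneg_right Nat.cast_div_le hM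

lemma sum_norm_sum_ite_sq_le {K K' N : ℕ} {E : ℝ} {b : ℕ → ℝ} {z : ℕ → ℂ} (hK : 0 < K)
    (hE : 0 ≤ E) (hz : ∀ n, ‖z n‖ ≤ 1)
    (hcor : ∀ k k', K < k → k < k' → k' ≤ K' →
      ‖∑ l ∈ Ioc 0 (N / k'), z (k * l) * conj (z (k' * l))‖ ≤ E * (N / K)) :
    ∑ l ∈ Ioc 0 (N / K),
        ‖∑ k ∈ Ioc K K', if l ∈ Ioc 0 (N / k) then (b k : ℂ) * z (k * l) else 0‖ ^ 2 ≤
      N / K * ∑ k ∈ Ioc K K', |b k| ^ 2 + E * (N / K) * (∑ k ∈ Ioc K K', |b k|) ^ 2 := by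
  set a : ℕ → ℕ → ℂ := fun k l ↦ if l ∈ Ioc 0 (N / k) then b k * z (k * l) else 0 with ha
  have hnorm (k l : ℕ) : ‖a k l‖ ≤ |b k| := by
    simp only [ha]
    split_ifs
    · rw [norm_mul, Complex.norm_real, norm_eq_abs]
      exact mul_le_of_le_one_right (abs_nonneg _) (hz _)
    · rw [norm_zero]
      exact abs_nonneg _
  have hdiag : ∀ k ∈ Ioc K K', ∑ l ∈ Ioc 0 (N / K), 1 * ‖a k l‖ ^ 2 ≤ N / K * |b k| ^ 2 := by
    intro k _
    refine sum_Ioc_div_le_mul (sq_nonneg _) fun l _ ↦ ?_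
    rw [one_mul]
    exact pow_le_pow_left₀ (norm_nonneg _) (hnorm k l) 2
  have hoff : ∀ k ∈ Ioc K K', ∀ k' ∈ Ioc K K', k < k' →
      ‖∑ l ∈ Ioc 0 (N / K), ((1 : ℝ) : ℂ) * (a k l * conj (a k' l))‖ ≤
        E * (N / K) * (|b k| * |b k'|) := by
    intro k hk k' hk' hlt
    obtain ⟨hKk, -⟩ := mem_Ioc.1 hk
    obtain ⟨hKk', hk'K⟩ := mem_Ioc.1 hk'
    have hterm (l : ℕ) : ((1 : ℝ) : ℂ) * (a k l * conj (a k' l)) =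
        if l ∈ Ioc 0 (N / k') then
          ((b k * b k' : ℝ) : ℂ) * (z (k * l) * conj (z (k' * l))) else 0 := by
      by_cases hl : l ∈ Ioc 0 (N / k')
      · have hl' := Ioc_subset_Ioc_right (Nat.div_le_div_left hlt.le (hK.trans hKk)) hl
        simp only [ha, if_pos hl, if_pos hl', map_mul, Complex.conj_ofReal]
        push_cast
        ring
      · simp only [ha, if_neg hl, map_zero, mul_zero]
    rw [sum_congr rfl fun l _ ↦ hterm l, sum_ite_mem, inter_eq_right.2
      (Ioc_subset_Ioc_right (Nat.div_le_div_left hKk'.le hK)), ← mul_sum, norm_mul,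
      Complex.norm_real, norm_eq_abs, abs_mul, mul_comm]
    exact mul_le_mul_of_nonneg_right (hcor k k' hKk hlt hk'K) (by positivity)
  simpa only [one_mul] using sum_mul_norm_sum_sq_le (by positivity) hdiag hoff

lemma norm_sum_mul_sum_sq_le {K K' N : ℕ} {G E : ℝ} {b g : ℕ → ℝ} {z : ℕ → ℂ} (hK : 0 < K)
    (hE : 0 ≤ E) (hz : ∀ n, ‖z n‖ ≤ 1) (hg : ∀ l ≤ N, |g l| ≤ G)
    (hcor : ∀ k k', K < k → k < k' → k' ≤ K' →
      ‖∑ l ∈ Ioc 0 (N / k'), z (k * l) * conj (z (k' * l))‖ ≤ E * (N / K)) :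
    ‖∑ k ∈ Ioc K K', (b k : ℂ) * ∑ l ∈ Ioc 0 (N / k), (g l : ℂ) * z (k * l)‖ ^ 2 ≤
      (N / K : ℝ) ^ 2 * G ^ 2 * (∑ k ∈ Ioc K K', |b k| ^ 2 + E * (∑ k ∈ Ioc K K', |b k|) ^ 2) := by
  set F : ℕ → ℂ := fun l ↦ ∑ k ∈ Ioc K K', if l ∈ Ioc 0 (N / k) then b k * z (k * l) else 0 with hF
  have hswap : ∑ k ∈ Ioc K K', (b k : ℂ) * ∑ l ∈ Ioc 0 (N / k), (g l : ℂ) * z (k * l) =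
      ∑ l ∈ Ioc 0 (N / K), (g l : ℂ) * F l := by
    simp only [hF, mul_sum, sum_Ioc_sum_Ioc_div_comm hK, mul_ite, mul_zero, mul_left_comm]
  have htriangle : ‖∑ l ∈ Ioc 0 (N / K), (g l : ℂ) * F l‖ ≤ ∑ l ∈ Ioc 0 (N / K), |g l| * ‖F l‖ :=
    norm_sum_le_of_le _ fun l _ ↦ by rw [norm_mul, Complex.norm_real, norm_eq_abs]
  have hsq : ∑ l ∈ Ioc 0 (N / K), |g l| ^ 2 ≤ N / K * G ^ 2 :=
    sum_Ioc_div_le_mul (sq_nonneg _) fun l hl ↦ pow_le_pow_left₀ (abs_nonneg _)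
      (hg l ((mem_Ioc.1 hl).2.trans (Nat.div_le_self _ _))) 2
  rw [hswap]
  calc ‖∑ l ∈ Ioc 0 (N / K), (g l : ℂ) * F l‖ ^ 2
      ≤ (∑ l ∈ Ioc 0 (N / K), |g l| * ‖F l‖) ^ 2 := pow_le_pow_left₀ (norm_nonneg _) htriangle 2
    _ ≤ (∑ l ∈ Ioc 0 (N / K), |g l| ^ 2) * ∑ l ∈ Ioc 0 (N / K), ‖F l‖ ^ 2 :=
        sum_mul_sq_le_sq_mul_sq _ _ _
    _ ≤ (N / K * G ^ 2) * (N / K * ∑ k ∈ Ioc K K', |b k| ^ 2 +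
          E * (N / K) * (∑ k ∈ Ioc K K', |b k|) ^ 2) :=
        mul_le_mul hsq (sum_norm_sum_ite_sq_le hK hE hz hcor) (sum_nonneg fun _ _ ↦ sq_nonneg _)
          (by positivity)
    _ = _ := by ring

lemma sum_Ioc_le_of_le_card_divisors {K K' N : ℕ} {b : ℕ → ℝ} (hKK' : K' ≤ 2 * K) (hKN : K' ≤ N)
    (hb : ∀ k, b k ≤ #k.divisors) :
    ∑ k ∈ Ioc K K', b k ≤ 2 * K * (1 + Real.log N) := by
  calc ∑ k ∈ Ioc K K', b k ≤ ∑ k ∈ Ioc K K', (#k.divisors : ℝ) := sum_le_sum fun k _ ↦ hb k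
    _ ≤ ∑ k ∈ Ioc 0 K', (#k.divisors : ℝ) :=
        sum_le_sum_of_subset_of_nonneg (Ioc_subset_Ioc_left K.zero_le) fun _ _ _ ↦ Nat.cast_nonneg _
    _ ≤ K' * (1 + Real.log K') := sum_card_divisors_le K'
    _ ≤ 2 * K * (1 + Real.log N) := by
        gcongr ?_ * (1 + ?_)
        · exact_mod_cast hKK'
        · exact log_natCast_le_log_natCast hKN

lemma sum_Ioc_sq_le_of_le_card_divisors {K K' : ℕ} {b : ℕ → ℝ} (hKK' : K' ≤ 2 * K)
    (hb₀ : ∀ k, 0 ≤ b k) (hb : ∀ k, b k ≤ #k.divisors) :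
    ∑ k ∈ Ioc K K', b k ^ 2 ≤ 3 * √K * ∑ k ∈ Ioc K K', b k := by
  rw [mul_sum]
  refine sum_le_sum fun k hk ↦ ?_
  have hk : (k : ℝ) ≤ 2 * K := by exact_mod_cast (mem_Ioc.1 hk).2.trans hKK'
  have hsqrt : √(k : ℝ) ≤ 3 / 2 * √K := by
    rw [sqrt_le_left (by positivity), mul_pow, sq_sqrt K.cast_nonneg]
    linarith [(K.cast_nonneg : (0 : ℝ) ≤ K)]
  have hle : b k ≤ 3 * √K := by linarith [hb k, card_divisors_le_two_mul_sqrt k]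
  rw [sq]
  exact mul_le_mul_of_nonneg_right hle (hb₀ k)

lemma norm_sum_mul_sum_le_of_le_card_divisors {V K K' N : ℕ} {G E : ℝ} {b g : ℕ → ℝ} {z : ℕ → ℂ}
    (hV : 0 < V) (hVK : V ≤ K) (hKK' : K' ≤ 2 * K) (hKN : K' ≤ N) (hE : 0 ≤ E)
    (hz : ∀ n, ‖z n‖ ≤ 1) (hb : ∀ k, |b k| ≤ #k.divisors) (hG : 0 ≤ G) (hg : ∀ l ≤ N, |g l| ≤ G)
    (hcor : ∀ k k', K < k → k < k' → k' ≤ K' →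
      ‖∑ l ∈ Ioc 0 (N / k'), z (k * l) * conj (z (k' * l))‖ ≤ E * (N / K)) :
    ‖∑ k ∈ Ioc K K', (b k : ℂ) * ∑ l ∈ Ioc 0 (N / k), (g l : ℂ) * z (k * l)‖ ≤
      N * G * (1 + Real.log N) * √(6 / √V + 4 * E) := by
  have hL : 1 ≤ 1 + Real.log N := le_add_of_nonneg_right (Real.log_natCast_nonneg N)
  set L := 1 + Real.log N
  have hK : (0 : ℝ) < K := by exact_mod_cast hV.trans_le hVK
  have hsum : ∑ k ∈ Ioc K K', |b k| ≤ 2 * K * L := sum_Ioc_le_of_le_card_divisors hKK' hKN hb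
  have hsq : ∑ k ∈ Ioc K K', |b k| ^ 2 ≤ 3 * √K * (2 * K * L) :=
    (sum_Ioc_sq_le_of_le_card_divisors hKK' (fun _ ↦ abs_nonneg _) hb).trans
      (mul_le_mul_of_nonneg_left hsum (by positivity))
  refine (sq_le_sq₀ (norm_nonneg _) (by positivity)).1 ?_
  calc ‖∑ k ∈ Ioc K K', (b k : ℂ) * ∑ l ∈ Ioc 0 (N / k), (g l : ℂ) * z (k * l)‖ ^ 2
      ≤ (N / K : ℝ) ^ 2 * G ^ 2 *
          (∑ k ∈ Ioc K K', |b k| ^ 2 + E * (∑ k ∈ Ioc K K', |b k|) ^ 2) :=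
        norm_sum_mul_sum_sq_le (hV.trans_le hVK) hE hz hg hcor
    _ ≤ (N / K : ℝ) ^ 2 * G ^ 2 * (3 * √K * (2 * K * L ^ 2) + E * (2 * K * L) ^ 2) := by
        have hLsq : L ≤ L ^ 2 := le_self_pow₀ hL two_ne_zero
        refine mul_le_mul_of_nonneg_left (add_le_add (hsq.trans ?_) ?_) (by positivity) <;> gcongr
    _ = (N * G * L) ^ 2 * (6 / √K + 4 * E) := by
        have hsqrt : √(K : ℝ) ^ 2 = K := sq_sqrt hK.le
        have := sqrt_pos.2 hK
        field_simp
        linear_combination N ^ 2 * G ^ 2 * 6 * hsqrt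
    _ ≤ (N * G * L) ^ 2 * (6 / √V + 4 * E) := by
        gcongr
    _ = (N * G * L * √(6 / √V + 4 * E)) ^ 2 := by
        rw [mul_pow _ (√_), sq_sqrt (by positivity)]

lemma norm_sum_Ioc_le_of_dyadic {V N : ℕ} {u : ℕ → ℂ} {B : ℝ}
    (hblock : ∀ K K', V ≤ K → K' ≤ 2 * K → K' ≤ N → ‖∑ k ∈ Ioc K K', u k‖ ≤ B) (J : ℕ) :
    ∀ N' ≤ N, N' ≤ V * 2 ^ J → ‖∑ k ∈ Ioc V N', u k‖ ≤ J * B := by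
  induction J with
  | zero =>
    intro N' _ hN'
    rw [Ioc_eq_empty_of_le (by simpa using hN'), sum_empty, norm_zero, Nat.cast_zero, zero_mul]
  | succ J ih =>
    intro N' hN'N hN'
    have hVJ : V ≤ V * 2 ^ J := Nat.le_mul_of_pos_right V (by positivity)
    rcases le_or_gt N' (V * 2 ^ J) with hle | hlt
    · have hB : 0 ≤ B := (norm_nonneg _).trans (hblock V 0 le_rfl (Nat.zero_le _) N.zero_le)
      refine (ih N' hN'N hle).trans (mul_le_mul_of_nonneg_right ?_ hB)
      exact_mod_cast J.le_succ
    · rw [← sum_Ioc_consecutive u hVJ hlt.le, Nat.cast_succ, add_one_mul]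
      refine (norm_add_le _ _).trans (add_le_add (ih _ (hlt.le.trans hN'N) le_rfl) ?_)
      exact hblock _ _ hVJ (by rwa [mul_left_comm, ← pow_succ']) hN'N

/-! ### Prime sums from bilinear sums -/

lemma norm_sum_lowPart_vonMangoldt_mul_le {z : ℕ → ℂ} (hz : ∀ n, ‖z n‖ ≤ 1) (V N : ℕ) :
    ‖∑ n ∈ Ioc 0 N, (lowPart V Λ n : ℂ) * z n‖ ≤ 6 * V := by
  have hterm (n : ℕ) : (lowPart V Λ n : ℂ) * z n = if n ∈ Ioc 0 V then (Λ n : ℂ) * z n else 0 := by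
    rw [lowPart_apply]
    rcases n.eq_zero_or_pos with rfl | hn
    · simp
    · by_cases hnV : n ≤ V <;> simp [hn, hnV]
  rw [sum_congr rfl fun n _ ↦ hterm n, sum_ite_mem, Ioc_inter_Ioc, max_self]
  refine (norm_sum_vonMangoldt_mul_le hz _).trans ?_
  gcongr
  exact min_le_right N V

lemma norm_sum_lowPart_moebius_mul_log_le {V N : ℕ} {E : ℝ} {z : ℕ → ℂ} (hE : 0 ≤ E)
    (hI : ∀ k Y, 0 < k → k ≤ V → Y ≤ N / k → ‖∑ l ∈ Ioc 0 Y, z (k * l)‖ ≤ E * (N / k)) :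
    ‖∑ n ∈ Ioc 0 N, ((lowPart V μ * ArithmeticFunction.log) n : ℂ) * z n‖ ≤
      2 * E * N * (1 + Real.log N) ^ 2 := by
  rw [sum_Ioc_mul_apply_mul]
  refine (norm_sum_mul_le_of_norm_le_div (V := V) (G := 2 * E * (1 + Real.log N)) zero_le_one
    (by positivity) (fun k _ ↦ (abs_lowPart_le V μ k).trans (abs_moebius_real_le_one k))
    (fun k hk ↦ if_neg hk.not_ge) fun k hk hkV ↦ ?_).trans_eq (by ring)
  refine (norm_sum_Ioc_monotone_mul_le (w := ArithmeticFunction.log)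
    (fun _ _ ↦ log_natCast_le_log_natCast) (Real.log_natCast_nonneg 0)
    fun Y hY ↦ hI k Y hk hkV hY).trans ?_
  have hle : ArithmeticFunction.log (N / k) ≤ 1 + Real.log N :=
    (log_natCast_le_log_natCast (Nat.div_le_self N k)).trans (le_add_of_nonneg_left zero_le_one)
  refine (mul_le_mul_of_nonneg_left hle (by positivity)).trans_eq ?_
  ring

lemma norm_sum_lowPart_mul_lowPart_mul_zeta_le {V N : ℕ} {E : ℝ} {z : ℕ → ℂ} (hE : 0 ≤ E)
    (hI : ∀ k Y, 0 < k → k ≤ V * V → Y ≤ N / k → ‖∑ l ∈ Ioc 0 Y, z (k * l)‖ ≤ E * (N / k)) :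
    ‖∑ n ∈ Ioc 0 N, ((lowPart V μ * lowPart V Λ * ζ) n : ℂ) * z n‖ ≤
      E * N * (1 + Real.log N) ^ 2 := by
  rw [sum_Ioc_mul_apply_mul]
  refine (norm_sum_mul_le_of_norm_le_div (V := V * V) (A := 1 + Real.log N) (by positivity) hE
    (fun k hk ↦ ?_) (fun k hk ↦ lowPart_mul_lowPart_eq_zero _ _ hk) fun k hk hkV ↦ ?_).trans_eq
    (by ring)
  · exact (abs_lowPart_moebius_mul_lowPart_vonMangoldt_le V k).trans
      ((log_natCast_le_log_natCast hk).trans (le_add_of_nonneg_left zero_le_one))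
  · refine (le_of_eq ?_).trans (hI k _ hk hkV le_rfl)
    congr 1
    refine sum_congr rfl fun l hl ↦ ?_
    rw [ArithmeticFunction.natCoe_apply, ArithmeticFunction.zeta_apply_ne (mem_Ioc.1 hl).1.ne']
    simp

lemma exists_le_two_pow_and_le_log (N : ℕ) :
    ∃ J : ℕ, N ≤ 2 ^ J ∧ (J : ℝ) ≤ 2 * (1 + Real.log N) := by
  have hlog := Real.log_natCast_nonneg N
  refine ⟨⌈2 * Real.log N⌉₊, ?_, ?_⟩
  · rcases N.eq_zero_or_pos with rfl | hN
    · exact Nat.zero_le _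
    · have hN' : (0 : ℝ) < N := by exact_mod_cast hN
      suffices (N : ℝ) ≤ 2 ^ ⌈2 * Real.log N⌉₊ by exact_mod_cast this
      rw [← Real.log_le_log_iff hN' (by positivity), Real.log_pow]
      calc Real.log N = 2 * Real.log N * (1 / 2) := by ring
        _ ≤ ⌈2 * Real.log N⌉₊ * Real.log 2 :=
          mul_le_mul (Nat.le_ceil _) (by linarith [Real.log_two_gt_d9]) (by norm_num)
            (Nat.cast_nonneg _)
  · linarith [Nat.ceil_lt_add_one (show 0 ≤ 2 * Real.log N by positivity)]

lemma sum_highPart_mul_eq_zero {V M : ℕ} (f : ArithmeticFunction ℝ) (h : M ≤ V) (w : ℕ → ℂ) :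
    ∑ l ∈ Ioc 0 M, (highPart V f l : ℂ) * w l = 0 := by
  refine sum_eq_zero fun l hl ↦ ?_
  rw [highPart_apply, if_pos ((mem_Ioc.1 hl).2.trans h), Complex.ofReal_zero, zero_mul]

lemma norm_sum_highPart_mul_highPart_le {V N : ℕ} {E : ℝ} {z : ℕ → ℂ} (hV : 0 < V) (hE : 0 ≤ E)
    (hz : ∀ n, ‖z n‖ ≤ 1)
    (hII : ∀ K k k', V ≤ K → K * V < N → K < k → k < k' → k' ≤ 2 * K → k' ≤ N →
      ‖∑ l ∈ Ioc 0 (N / k'), z (k * l) * conj (z (k' * l))‖ ≤ E * (N / K)) :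
    ‖∑ n ∈ Ioc 0 N, ((highPart V μ * ζ * highPart V Λ) n : ℂ) * z n‖ ≤
      2 * N * (1 + Real.log N) ^ 3 * √(6 / √V + 4 * E) := by
  set L := 1 + Real.log N
  set u : ℕ → ℂ := fun k ↦ ((highPart V μ * ζ : ArithmeticFunction ℝ) k : ℂ) *
    ∑ l ∈ Ioc 0 (N / k), (highPart V Λ l : ℂ) * z (k * l) with hu
  have hlow : ∑ k ∈ Ioc 0 N, u k = ∑ k ∈ Ioc V N, u k := by
    refine (sum_subset (Ioc_subset_Ioc_left V.zero_le) fun k hk hk' ↦ ?_).symm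
    have hkV : k ≤ V := le_of_not_gt fun h ↦ hk' (mem_Ioc.2 ⟨h, (mem_Ioc.1 hk).2⟩)
    simp only [hu, highPart_mul_zeta_eq_zero _ hkV, Complex.ofReal_zero, zero_mul]
  have hΛ (l : ℕ) (hl : l ≤ N) : |highPart V Λ l| ≤ L := by
    refine (abs_highPart_le V Λ l).trans ?_
    rw [abs_of_nonneg ArithmeticFunction.vonMangoldt_nonneg]
    exact ArithmeticFunction.vonMangoldt_le_log.trans
      ((log_natCast_le_log_natCast hl).trans (le_add_of_nonneg_left zero_le_one))
  have hblock (K K' : ℕ) (hVK : V ≤ K) (hKK' : K' ≤ 2 * K) (hKN : K' ≤ N) :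
      ‖∑ k ∈ Ioc K K', u k‖ ≤ N * L * L * √(6 / √V + 4 * E) := by
    rcases lt_or_ge (K * V) N with hlt | hge
    · exact norm_sum_mul_sum_le_of_le_card_divisors hV hVK hKK' hKN hE hz
        (abs_highPart_moebius_mul_zeta_le V) (by positivity) hΛ fun k k' hk hkk' hk' ↦
          hII K k k' hVK hlt hk hkk' (hk'.trans hKK') (hk'.trans hKN)
    · rw [sum_eq_zero, norm_zero]
      · positivity
      · intro k hk
        have hKk := (mem_Ioc.1 hk).1
        have hNk : N / k ≤ V := Nat.div_le_of_le_mul (hge.trans (Nat.mul_le_mul_right V hKk.le))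
        simp only [hu, sum_highPart_mul_eq_zero _ hNk, mul_zero]
  obtain ⟨J, hNJ, hJ⟩ := exists_le_two_pow_and_le_log N
  rw [sum_Ioc_mul_apply_mul, hlow]
  calc ‖∑ k ∈ Ioc V N, u k‖ ≤ J * (N * L * L * √(6 / √V + 4 * E)) :=
        norm_sum_Ioc_le_of_dyadic hblock J N le_rfl (hNJ.trans (Nat.le_mul_of_pos_left _ hV))
    _ ≤ 2 * L * (N * L * L * √(6 / √V + 4 * E)) :=
        mul_le_mul_of_nonneg_right hJ (by positivity)
    _ = 2 * N * L ^ 3 * √(6 / √V + 4 * E) := by ring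

theorem norm_sum_vonMangoldt_mul_le_of_bilinear {V N : ℕ} {E : ℝ} {z : ℕ → ℂ} (hV : 0 < V)
    (hE : 0 ≤ E) (hz : ∀ n, ‖z n‖ ≤ 1)
    (hI : ∀ k Y, 0 < k → k ≤ V * V → Y ≤ N / k → ‖∑ l ∈ Ioc 0 Y, z (k * l)‖ ≤ E * (N / k))
    (hII : ∀ K k k', V ≤ K → K * V < N → K < k → k < k' → k' ≤ 2 * K → k' ≤ N →
      ‖∑ l ∈ Ioc 0 (N / k'), z (k * l) * conj (z (k' * l))‖ ≤ E * (N / K)) :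
    ‖∑ n ∈ Ioc 0 N, (Λ n : ℂ) * z n‖ ≤ 6 * V + 3 * E * N * (1 + Real.log N) ^ 2 +
      2 * N * (1 + Real.log N) ^ 3 * √(6 / √V + 4 * E) := by
  have hlow := norm_sum_lowPart_vonMangoldt_mul_le hz V N
  have hlog := norm_sum_lowPart_moebius_mul_log_le hE fun k Y hk hkV ↦
    hI k Y hk (hkV.trans (Nat.le_mul_of_pos_left V hV))
  have hzeta := norm_sum_lowPart_mul_lowPart_mul_zeta_le hE hI
  have hhigh := norm_sum_highPart_mul_highPart_le hV hE hz hII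
  have hvaughan : ∑ n ∈ Ioc 0 N, (Λ n : ℂ) * z n =
      ∑ n ∈ Ioc 0 N, (lowPart V Λ n : ℂ) * z n +
      ∑ n ∈ Ioc 0 N, ((lowPart V μ * ArithmeticFunction.log) n : ℂ) * z n +
      ∑ n ∈ Ioc 0 N, ((highPart V μ * ζ * highPart V Λ) n : ℂ) * z n -
      ∑ n ∈ Ioc 0 N, ((lowPart V μ * lowPart V Λ * ζ) n : ℂ) * z n := by
    rw [eq_sub_iff_add_eq, ← sum_add_distrib, ← sum_add_distrib, ← sum_add_distrib]
    refine sum_congr rfl fun n _ ↦ ?_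
    have h := congrArg (fun f : ArithmeticFunction ℝ ↦ (f n : ℂ)) (vonMangoldt_add_lowPart_mul V)
    simp only [ArithmeticFunction.add_apply, Complex.ofReal_add] at h
    rw [← add_mul, h]
    ring
  rw [hvaughan]
  refine (norm_sub_le _ _).trans ((add_le_add (norm_add₃_le.trans
    (add_le_add_three hlow hlog hhigh)) hzeta).trans_eq ?_)
  ring

/-! ### The exponential sum over primes -/

lemma one_le_rpow_sub_rpow {c : ℝ} (hc : 1 ≤ c) {k l : ℕ} (h : k < l) :
    1 ≤ (l : ℝ) ^ c - (k : ℝ) ^ c := by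
  have hadd := Real.add_rpow_le_rpow_add k.cast_nonneg zero_le_one hc
  have hmono : ((k : ℝ) + 1) ^ c ≤ (l : ℝ) ^ c := by
    gcongr
    exact_mod_cast h
  rw [one_rpow] at hadd
  linarith

lemma mul_natCast_mul_rpow (α c : ℝ) (k l : ℕ) :
    α * ((k * l : ℕ) : ℝ) ^ c = α * (k : ℝ) ^ c * (l : ℝ) ^ c := by
  rw [Nat.cast_mul, mul_rpow k.cast_nonneg l.cast_nonneg, mul_assoc]

/-- Sums of `𝐞 (β n ^ c)` over initial intervals are bounded by `E` times the length, uniformly in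
lengths at least `N ^ (1 / 8)` and in the frequencies that Vaughan's identity produces when it is
applied to `𝐞 (α n ^ c)` on `(0, N]` with `N ^ (-θ) ≤ α ≤ N ^ θ`. -/
def RpowSumBound (c θ E N : ℝ) : Prop :=
  ∀ (X β : ℝ) (Y : ℕ), N ^ (1 / 8 : ℝ) ≤ X → Y ≤ X → N ^ (-θ) ≤ |β| → |β| ≤ N ^ (θ + c) →
    ‖∑ n ∈ Ioc 0 Y, (𝐞 (β * (n : ℝ) ^ c) : ℂ)‖ ≤ E * X

lemma exists_rpowSumBound {c : ℝ} (hc : 1 < c) (hcZ : ∀ k : ℤ, c ≠ k) :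
    ∃ η C : ℝ, 0 < η ∧ η ≤ 1 / 16 ∧ 0 ≤ C ∧
      ∀ N : ℝ, 1 ≤ N → RpowSumBound c ((c - 1) / 16) (C * N ^ (-η)) N := by
  obtain ⟨η, C, hη₀, hη₁, hC₀, hC⟩ :=
    exists_norm_sum_fourierChar_mul_rpow_le hc hcZ (8 * ((c - 1) / 16 + c))
  refine ⟨η / 8, C, by positivity, by linarith, hC₀, ?_⟩
  intro N hN X β Y hNX hYX hβ₁ hβ₂
  have hN₀ : 0 < N := one_pos.trans_le hN
  have hX : 1 ≤ X := (one_le_rpow hN (by norm_num)).trans hNX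
  have hX₀ : 0 < X := one_pos.trans_le hX
  have hNX₈ : N ≤ X ^ (8 : ℝ) := by
    calc N = (N ^ (1 / 8 : ℝ)) ^ (8 : ℝ) := by rw [← rpow_mul hN₀.le]; norm_num
      _ ≤ X ^ (8 : ℝ) := by gcongr
  have hlow : X ^ (-((c - 1) / 2)) ≤ N ^ (-((c - 1) / 16)) := by
    calc X ^ (-((c - 1) / 2)) = (X ^ (8 : ℝ)) ^ (-((c - 1) / 16)) := by
          rw [← rpow_mul hX₀.le]; ring_nf
      _ ≤ N ^ (-((c - 1) / 16)) := rpow_le_rpow_of_nonpos hN₀ hNX₈ (by linarith)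
  have hhigh : N ^ ((c - 1) / 16 + c) ≤ X ^ (8 * ((c - 1) / 16 + c)) := by
    rw [rpow_mul hX₀.le]
    exact rpow_le_rpow hN₀.le hNX₈ (by linarith)
  have hsaving : X ^ (-η) ≤ N ^ (-(η / 8)) := by
    calc X ^ (-η) ≤ (N ^ (1 / 8 : ℝ)) ^ (-η) :=
          rpow_le_rpow_of_nonpos (by positivity) hNX (by linarith)
      _ = N ^ (-(η / 8)) := by rw [← rpow_mul hN₀.le]; ring_nf
  calc ‖∑ n ∈ Ioc 0 Y, (𝐞 (β * (n : ℝ) ^ c) : ℂ)‖ ≤ C * X ^ (1 - η) :=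
        hC X β Y hX hYX (hlow.trans hβ₁) (hβ₂.trans hhigh)
    _ = C * X ^ (-η) * X := by rw [sub_eq_neg_add, rpow_add_one hX₀.ne', mul_assoc]
    _ ≤ C * N ^ (-(η / 8)) * X := by gcongr

section

variable {c θ E α X : ℝ} {N : ℕ}

lemma RpowSumBound.norm_sum_dilate_le (h : RpowSumBound c θ E N) (hc : 1 ≤ c)
    (hα₁ : (N : ℝ) ^ (-θ) ≤ α) (hα₂ : α ≤ (N : ℝ) ^ θ) {k Y : ℕ} (hk : 0 < k) (hkN : k ≤ N)
    (hX : (N : ℝ) ^ (1 / 8 : ℝ) ≤ X) (hY : Y ≤ X) :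
    ‖∑ l ∈ Ioc 0 Y, (𝐞 (α * ((k * l : ℕ) : ℝ) ^ c) : ℂ)‖ ≤ E * X := by
  have hN₀ : (0 : ℝ) < N := by exact_mod_cast hk.trans_le hkN
  have hk₁ : (1 : ℝ) ≤ k := by exact_mod_cast hk
  have hα₀ : 0 < α := (rpow_pos_of_pos hN₀ _).trans_le hα₁
  have habs : |α * (k : ℝ) ^ c| = α * (k : ℝ) ^ c := abs_of_nonneg (by positivity)
  simp only [mul_natCast_mul_rpow]
  refine h X _ Y hX hY ?_ ?_
  · rw [habs]
    exact hα₁.trans (le_mul_of_one_le_right hα₀.le (one_le_rpow hk₁ (by linarith)))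
  · rw [habs, rpow_add hN₀]
    gcongr

lemma RpowSumBound.norm_sum_correlation_le (h : RpowSumBound c θ E N) (hc : 1 ≤ c)
    (hα₁ : (N : ℝ) ^ (-θ) ≤ α) (hα₂ : α ≤ (N : ℝ) ^ θ) {k k' Y : ℕ} (hkk' : k < k') (hkN : k' ≤ N)
    (hX : (N : ℝ) ^ (1 / 8 : ℝ) ≤ X) (hY : Y ≤ X) :
    ‖∑ l ∈ Ioc 0 Y, (𝐞 (α * ((k * l : ℕ) : ℝ) ^ c) : ℂ) *
      conj (𝐞 (α * ((k' * l : ℕ) : ℝ) ^ c) : ℂ)‖ ≤ E * X := by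
  have hN₀ : (0 : ℝ) < N := by exact_mod_cast (Nat.zero_le k).trans_lt (hkk'.trans_le hkN)
  have hα₀ : 0 < α := (rpow_pos_of_pos hN₀ _).trans_le hα₁
  have hgap := one_le_rpow_sub_rpow hc hkk'
  have habs : |α * (k : ℝ) ^ c - α * (k' : ℝ) ^ c| = α * ((k' : ℝ) ^ c - (k : ℝ) ^ c) := by
    rw [← mul_sub, abs_mul, abs_of_pos hα₀, abs_sub_comm, abs_of_pos (one_pos.trans_le hgap)]
  simp only [← coe_fourierChar_sub, mul_natCast_mul_rpow, ← sub_mul]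
  refine h X _ Y hX hY ?_ ?_
  · rw [habs]
    exact hα₁.trans (le_mul_of_one_le_right hα₀.le hgap)
  · have hle : (k' : ℝ) ^ c - (k : ℝ) ^ c ≤ (N : ℝ) ^ c := by
      refine (sub_le_self _ (by positivity)).trans ?_
      gcongr
    rw [habs, rpow_add hN₀]
    exact mul_le_mul hα₂ hle (by linarith) (by positivity)

lemma RpowSumBound.norm_sum_vonMangoldt_mul_le_of_cutoff (h : RpowSumBound c θ E N) (hc : 1 ≤ c)
    (hN : 1 ≤ N) (hE : 0 ≤ E) (hα₁ : (N : ℝ) ^ (-θ) ≤ α) (hα₂ : α ≤ (N : ℝ) ^ θ) {V : ℕ}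
    (hV : 0 < V) (hV₁ : (N : ℝ) ^ (1 / 8 : ℝ) ≤ 2 * V)
    (hV₂ : (V : ℝ) * V * (N : ℝ) ^ (1 / 8 : ℝ) ≤ N) :
    ‖∑ n ∈ Ioc 0 N, (Λ n : ℂ) * 𝐞 (α * (n : ℝ) ^ c)‖ ≤
      6 * V + 3 * (2 * E) * N * (1 + Real.log N) ^ 2 +
        2 * N * (1 + Real.log N) ^ 3 * √(6 / √V + 4 * (2 * E)) := by
  have hN₁ : (1 : ℝ) ≤ N := by exact_mod_cast hN
  refine norm_sum_vonMangoldt_mul_le_of_bilinear (z := fun n ↦ (𝐞 (α * (n : ℝ) ^ c) : ℂ)) hV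
    (by positivity) (fun n ↦ (Circle.norm_coe _).le) ?_ ?_
  · intro k Y hk hkV hY
    have hk₀ : (0 : ℝ) < k := by exact_mod_cast hk
    have hkX : (k : ℝ) * (N : ℝ) ^ (1 / 8 : ℝ) ≤ N := by
      refine le_trans ?_ hV₂
      gcongr
      exact_mod_cast hkV
    have hkN : k ≤ N := by
      exact_mod_cast (le_mul_of_one_le_right hk₀.le (one_le_rpow hN₁ (by norm_num))).trans hkX
    refine (h.norm_sum_dilate_le hc hα₁ hα₂ hk hkN (X := N / k) ?_ ?_).trans ?_
    · rwa [le_div_iff₀' hk₀]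
    · exact (Nat.cast_le.2 hY).trans Nat.cast_div_le
    · gcongr
      linarith
  · intro K k k' hVK hKV hk hkk' _ hk'
    have hK : (0 : ℝ) < K := by exact_mod_cast hV.trans_le hVK
    have hKV' : (K : ℝ) * V < N := by exact_mod_cast hKV
    refine (h.norm_sum_correlation_le hc hα₁ hα₂ hkk' hk' (X := 2 * (N / K)) ?_ ?_).trans_eq
      (by ring)
    · rw [← mul_div_assoc, le_div_iff₀ hK]
      linarith [mul_le_mul_of_nonneg_right hV₁ hK.le]
    · calc ((N / k' : ℕ) : ℝ) ≤ (N / K : ℕ) := by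
            exact_mod_cast Nat.div_le_div_left (hk.trans hkk').le (hV.trans_le hVK)
        _ ≤ N / K := Nat.cast_div_le
        _ ≤ 2 * (N / K) := le_mul_of_one_le_left (by positivity) one_le_two

theorem RpowSumBound.norm_sum_vonMangoldt_mul_le (h : RpowSumBound c θ E N) (hc : 1 ≤ c)
    (hN : 1 ≤ N) (hE : 0 ≤ E) (hα₁ : (N : ℝ) ^ (-θ) ≤ α) (hα₂ : α ≤ (N : ℝ) ^ θ) :
    ‖∑ n ∈ Ioc 0 N, (Λ n : ℂ) * 𝐞 (α * (n : ℝ) ^ c)‖ ≤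
      6 * (N : ℝ) ^ (1 / 8 : ℝ) + 6 * E * N * (1 + Real.log N) ^ 2 +
        2 * N * (1 + Real.log N) ^ 3 * √(9 * (N : ℝ) ^ (-(1 / 16) : ℝ) + 8 * E) := by
  have hN₁ : (1 : ℝ) ≤ N := by exact_mod_cast hN
  have hN₀ : (0 : ℝ) < N := one_pos.trans_le hN₁
  obtain ⟨t, ht⟩ : ∃ t, t = (N : ℝ) ^ (1 / 8 : ℝ) := ⟨_, rfl⟩
  have ht₁ : 1 ≤ t := ht ▸ one_le_rpow hN₁ (by norm_num)
  obtain ⟨V, hV, hVt, htV⟩ : ∃ V : ℕ, 0 < V ∧ (V : ℝ) ≤ t ∧ t ≤ 2 * V := by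
    have hpos : 0 < ⌊t⌋₊ := Nat.floor_pos.2 ht₁
    have hone : (1 : ℝ) ≤ ⌊t⌋₊ := by exact_mod_cast hpos
    exact ⟨⌊t⌋₊, hpos, Nat.floor_le (by positivity), by linarith [Nat.lt_floor_add_one t]⟩
  have hVVt : (V : ℝ) * V * t ≤ N := by
    calc (V : ℝ) * V * t ≤ t * t * t := by gcongr
      _ = (N : ℝ) ^ (3 / 8 : ℝ) := by rw [ht, ← rpow_add hN₀, ← rpow_add hN₀]; norm_num
      _ ≤ N := rpow_le_self_of_one_le hN₁ (by norm_num)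
  have hVsqrt : 6 / √V ≤ 9 * (N : ℝ) ^ (-(1 / 16) : ℝ) := by
    have hsqrt : √t = (N : ℝ) ^ (1 / 16 : ℝ) := by
      rw [ht, sqrt_eq_rpow, ← rpow_mul hN₀.le]
      norm_num
    rw [rpow_neg hN₀.le, ← hsqrt, ← div_eq_mul_inv, div_le_div_iff₀ (by positivity) (by positivity)]
    have hle : √t ≤ 3 / 2 * √V := by
      rw [sqrt_le_left (by positivity), mul_pow, sq_sqrt V.cast_nonneg]
      linarith
    linarith
  refine (h.norm_sum_vonMangoldt_mul_le_of_cutoff hc hN hE hα₁ hα₂ hV (ht ▸ htV)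
    (ht ▸ hVVt)).trans ?_
  rw [← ht]
  gcongr ?_ + ?_ + _ * √?_
  · gcongr
  · exact le_of_eq (by ring)
  · linarith

end

lemma exists_one_add_log_pow_le (k : ℕ) {ε : ℝ} (hε : 0 < ε) :
    ∃ C : ℝ, 0 < C ∧ ∀ N : ℕ, 1 ≤ N → (1 + Real.log N) ^ k ≤ C * (N : ℝ) ^ ε := by
  set r := ε / (k + 1) with hr
  have hr₀ : 0 < r := by positivity
  refine ⟨(1 + 1 / r) ^ k, by positivity, fun N hN ↦ ?_⟩
  have hN₁ : (1 : ℝ) ≤ N := by exact_mod_cast hN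
  have hlog : 1 + Real.log N ≤ (1 + 1 / r) * (N : ℝ) ^ r := by
    rw [add_mul, one_mul, one_div_mul_eq_div]
    exact add_le_add (one_le_rpow hN₁ hr₀.le) (Real.log_le_rpow_div N.cast_nonneg hr₀)
  have hrk : r * k ≤ ε := by
    rw [hr, div_mul_eq_mul_div, div_le_iff₀ (by positivity)]
    linarith
  calc (1 + Real.log N) ^ k ≤ ((1 + 1 / r) * (N : ℝ) ^ r) ^ k := by gcongr
    _ = (1 + 1 / r) ^ k * (N : ℝ) ^ (r * k) := by
        rw [mul_pow, ← rpow_natCast ((N : ℝ) ^ r), ← rpow_mul N.cast_nonneg]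
    _ ≤ (1 + 1 / r) ^ k * (N : ℝ) ^ ε := by gcongr

theorem exists_norm_sum_vonMangoldt_mul_fourierChar_le {c : ℝ} (hc : 1 < c) (hcZ : ∀ k : ℤ, c ≠ k) :
    ∃ θ η C : ℝ, 0 < θ ∧ 0 < η ∧ η ≤ 1 ∧ 0 ≤ C ∧ ∀ (N : ℕ) (α : ℝ), 1 ≤ N →
      (N : ℝ) ^ (-θ) ≤ α → α ≤ (N : ℝ) ^ θ →
      ‖∑ n ∈ Ioc 0 N, (Λ n : ℂ) * 𝐞 (α * (n : ℝ) ^ c)‖ ≤ C * (N : ℝ) ^ (1 - η) := by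
  obtain ⟨η, C, hη₀, hη₁, hC₀, hC⟩ := exists_rpowSumBound hc hcZ
  obtain ⟨D, hD₀, hD⟩ := exists_one_add_log_pow_le 3 (show 0 < η / 4 by positivity)
  refine ⟨(c - 1) / 16, η / 4, 6 + 6 * C * D + 2 * D * √(9 + 8 * C), by linarith, by positivity,
    by linarith, by positivity, fun N α hN hα₁ hα₂ ↦ ?_⟩
  have hN₁ : (1 : ℝ) ≤ N := by exact_mod_cast hN
  have hN₀ : (0 : ℝ) < N := one_pos.trans_le hN₁
  have hbound := (hC N hN₁).norm_sum_vonMangoldt_mul_le hc.le hN (by positivity) hα₁ hα₂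
  set L := 1 + Real.log N
  have hL : 1 ≤ L := le_add_of_nonneg_right (Real.log_natCast_nonneg N)
  have hL₃ : L ^ 3 ≤ D * (N : ℝ) ^ (η / 4) := hD N hN
  have hL₂ : L ^ 2 ≤ D * (N : ℝ) ^ (η / 4) := (pow_le_pow_right₀ hL (by norm_num)).trans hL₃
  have hlow : (N : ℝ) ^ (1 / 8 : ℝ) ≤ (N : ℝ) ^ (1 - η / 4) :=
    rpow_le_rpow_of_exponent_le hN₁ (by linarith)
  have hlinear : 6 * (C * (N : ℝ) ^ (-η)) * N * L ^ 2 ≤ 6 * C * D * (N : ℝ) ^ (1 - η / 4) := by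
    calc 6 * (C * (N : ℝ) ^ (-η)) * N * L ^ 2
        ≤ 6 * (C * (N : ℝ) ^ (-η)) * N * (D * (N : ℝ) ^ (η / 4)) := by gcongr
      _ = 6 * C * D * (N : ℝ) ^ (-η + 1 + η / 4) := by
          rw [rpow_add hN₀, rpow_add_one hN₀.ne']
          ring
      _ ≤ 6 * C * D * (N : ℝ) ^ (1 - η / 4) := by
          gcongr
          linarith
  have hsqrt : √(9 * (N : ℝ) ^ (-(1 / 16) : ℝ) + 8 * (C * (N : ℝ) ^ (-η))) ≤
      √(9 + 8 * C) * (N : ℝ) ^ (-(η / 2)) := by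
    have hmono : (N : ℝ) ^ (-(1 / 16) : ℝ) ≤ (N : ℝ) ^ (-η) :=
      rpow_le_rpow_of_exponent_le hN₁ (by linarith)
    rw [sqrt_le_left (by positivity), mul_pow, sq_sqrt (by positivity), ← rpow_mul_natCast hN₀.le,
      show -(η / 2) * (2 : ℕ) = -η by push_cast; ring]
    linarith
  have hbilinear : 2 * N * L ^ 3 * √(9 * (N : ℝ) ^ (-(1 / 16) : ℝ) + 8 * (C * (N : ℝ) ^ (-η))) ≤
      2 * D * √(9 + 8 * C) * (N : ℝ) ^ (1 - η / 4) := by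
    calc 2 * N * L ^ 3 * √(9 * (N : ℝ) ^ (-(1 / 16) : ℝ) + 8 * (C * (N : ℝ) ^ (-η)))
        ≤ 2 * N * (D * (N : ℝ) ^ (η / 4)) * (√(9 + 8 * C) * (N : ℝ) ^ (-(η / 2))) := by gcongr
      _ = 2 * D * √(9 + 8 * C) * (N : ℝ) ^ (-(η / 2) + η / 4 + 1) := by
          rw [rpow_add_one hN₀.ne', rpow_add hN₀]
          ring
      _ = 2 * D * √(9 + 8 * C) * (N : ℝ) ^ (1 - η / 4) := by ring_nf
  linarith

/-! ### Equidistribution modulo one -/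

/-- The one-sided Dirichlet kernel `∑_{r < H} 𝐞 (r x)`, whose square `‖expKernel H x‖ ^ 2` is `H`
times the Fejér kernel. -/
noncomputable def expKernel (H : ℕ) (x : ℝ) : ℂ := ∑ r ∈ range H, (𝐞 (r * x) : ℂ)

lemma norm_expKernel_le {H : ℕ} {x D : ℝ} (j : ℤ) (hD : 0 < D) (h₁ : j + D ≤ x)
    (h₂ : x ≤ j + 1 - D) : ‖expKernel H x‖ ≤ 1 / (2 * D) := by
  have hgap : 4 * D ≤ ‖1 - (𝐞 x : ℂ)‖ :=
    (mul_le_mul_of_nonneg_left (le_abs_sub_round j h₁ h₂) (by norm_num)).trans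
      (four_mul_abs_sub_round_le x)
  have hgeom : expKernel H x * (1 - 𝐞 x) = 1 - 𝐞 (H * x) := by
    simp only [expKernel, fourierChar_natCast_mul, Circle.coe_pow]
    exact geom_sum_mul_neg _ _
  have hprod : ‖expKernel H x‖ * ‖1 - (𝐞 x : ℂ)‖ ≤ 2 := by
    rw [← norm_mul, hgeom]
    refine (norm_sub_le _ _).trans_eq ?_
    rw [norm_one, Circle.norm_coe]
    norm_num
  rw [le_div_iff₀ (by positivity)]
  linarith [mul_le_mul_of_nonneg_left hgap (norm_nonneg (expKernel H x))]

lemma sum_range_fourierChar_mul_div {H : ℕ} (hH : 0 < H) (k : ℤ) :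
    ∑ i ∈ range H, (𝐞 (i * (k / H)) : ℂ) = if (H : ℤ) ∣ k then (H : ℂ) else 0 := by
  have hH' : (H : ℝ) ≠ 0 := by positivity
  have hone : 𝐞 ((k : ℝ) / H) = 1 ↔ (H : ℤ) ∣ k := by
    rw [fourierChar_eq_one_iff, dvd_def]
    refine exists_congr fun j ↦ ?_
    rw [div_eq_iff hH', mul_comm]
    norm_cast
  simp only [fourierChar_natCast_mul, Circle.coe_pow]
  split_ifs with h
  · rw [hone.2 h]
    simp
  · have hne : (𝐞 ((k : ℝ) / H) : ℂ) ≠ 1 := fun h' ↦ h (hone.1 (Circle.ext h'))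
    have hpow : 𝐞 ((k : ℝ) / H) ^ H = 1 := by
      rw [← fourierChar_natCast_mul, mul_div_cancel₀ _ hH', fourierChar_eq_one_iff]
      exact ⟨k, rfl⟩
    rw [geom_sum_eq hne, ← Circle.coe_pow, hpow, Circle.coe_one, sub_self, zero_div]

lemma sum_norm_expKernel_sub_sq {H : ℕ} (hH : 0 < H) (y : ℝ) :
    ∑ i ∈ range H, ‖expKernel H (y - i / H)‖ ^ 2 = (H : ℝ) ^ 2 := by
  have horth : ∀ r ∈ range H, ∀ s ∈ range H,
      ∑ i ∈ range H, (𝐞 (r * (y - i / H)) : ℂ) * conj (𝐞 (s * (y - i / H)) : ℂ) =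
        if r = s then (H : ℂ) else 0 := by
    intro r hr s hs
    have hdvd : (H : ℤ) ∣ s - r ↔ r = s := by
      rw [← Nat.modEq_iff_dvd, Nat.ModEq, Nat.mod_eq_of_lt (mem_range.1 hr),
        Nat.mod_eq_of_lt (mem_range.1 hs)]
    have hterm (i : ℕ) : (𝐞 (r * (y - i / H)) : ℂ) * conj (𝐞 (s * (y - i / H)) : ℂ) =
        𝐞 ((r - s) * y) * 𝐞 (i * (((s - r : ℤ) : ℝ) / H)) := by
      rw [← coe_fourierChar_sub, ← Circle.coe_mul, ← AddChar.map_add_eq_mul]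
      push_cast
      ring_nf
    simp only [hterm, ← mul_sum]
    rw [sum_range_fourierChar_mul_div hH]
    simp only [hdvd]
    split_ifs with hrs
    · simp [hrs]
    · exact mul_zero _
  have hexpand := sum_mul_norm_sum_sq_eq (range H) (range H) (fun _ ↦ 1)
    fun r i ↦ (𝐞 (r * (y - i / H)) : ℂ)
  simp only [Complex.ofReal_one, one_mul] at hexpand
  simp only [expKernel]
  rw [hexpand, sum_congr rfl fun r hr ↦ sum_congr rfl fun s hs ↦
    congrArg Complex.re (horth r hr s hs)]
  simp only [apply_ite Complex.re, Complex.natCast_re, Complex.zero_re, sum_ite_eq]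
  rw [sum_congr rfl fun r hr ↦ if_pos hr, sum_const, card_range, nsmul_eq_mul, sq]

lemma sq_le_sum_norm_expKernel_sq_add {H : ℕ} (hH : 0 < H) {y l D : ℝ} (hD : 0 < D)
    (hy : Int.fract y < l) :
    (H : ℝ) ^ 2 ≤ ∑ i ∈ range H with ((i : ℕ) : ℝ) / H ≤ l + 2 * D,
      ‖expKernel H (y + D - i / H)‖ ^ 2 + H / (4 * D ^ 2) := by
  have hH₀ : (0 : ℝ) < H := by exact_mod_cast hH
  rw [← sum_norm_expKernel_sub_sq hH (y + D),
    ← sum_filter_add_sum_filter_not (range H) fun i : ℕ ↦ (i : ℝ) / H ≤ l + 2 * D]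
  refine add_le_add le_rfl ((sum_le_card_nsmul _ _ ((1 / (2 * D)) ^ 2) fun i hi ↦ ?_).trans ?_)
  · rw [mem_filter, mem_range, not_le] at hi
    have hi₁ : (i : ℝ) / H ≤ 1 := (div_le_one hH₀).2 (by exact_mod_cast hi.1.le)
    have hfract := Int.fract_nonneg y
    have hsplit := Int.floor_add_fract y
    gcongr
    refine norm_expKernel_le (⌊y⌋ - 1) hD ?_ ?_ <;> push_cast <;> linarith
  · calc _ ≤ H • (1 / (2 * D)) ^ 2 := by
          gcongr
          exact (card_filter_le _ _).trans_eq (card_range H)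
      _ = H / (4 * D ^ 2) := by
          rw [nsmul_eq_mul]
          ring

lemma card_filter_div_le {H : ℕ} (hH : 0 < H) {a : ℝ} (ha : 0 ≤ a) :
    (#{i ∈ range H | ((i : ℕ) : ℝ) / H ≤ a} : ℝ) ≤ a * H + 1 := by
  have hH₀ : (0 : ℝ) < H := by exact_mod_cast hH
  have hsub : {i ∈ range H | ((i : ℕ) : ℝ) / H ≤ a} ⊆ range (⌊a * H⌋₊ + 1) := by
    intro i hi
    rw [mem_range, Nat.lt_succ_iff]
    exact Nat.le_floor ((div_le_iff₀ hH₀).1 (mem_filter.1 hi).2)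
  have hcard := card_le_card hsub
  rw [card_range] at hcard
  calc (#{i ∈ range H | ((i : ℕ) : ℝ) / H ≤ a} : ℝ) ≤ ⌊a * H⌋₊ + 1 := by exact_mod_cast hcard
    _ ≤ a * H + 1 := by
        gcongr
        exact Nat.floor_le (by positivity)

lemma norm_sum_mul_fourierChar_mul_sub {ι : Type*} (s : Finset ι) (w x : ι → ℝ) (k y : ℝ) :
    ‖∑ n ∈ s, (w n : ℂ) * 𝐞 (k * (x n - y))‖ = ‖∑ n ∈ s, (w n : ℂ) * 𝐞 (k * x n)‖ := by
  simp only [mul_sub, coe_fourierChar_sub, ← mul_assoc, ← sum_mul]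
  rw [norm_mul, RCLike.norm_conj, Circle.norm_coe, mul_one]

section

variable {ι : Type*} {s : Finset ι} {w x : ι → ℝ} {H : ℕ} {E : ℝ}

lemma sum_mul_norm_expKernel_sq_le (hE₀ : 0 ≤ E)
    (hE : ∀ k : ℕ, 0 < k → k < H → ‖∑ n ∈ s, (w n : ℂ) * 𝐞 (k * x n)‖ ≤ E) (y : ℝ) :
    ∑ n ∈ s, w n * ‖expKernel H (x n - y)‖ ^ 2 ≤ (∑ n ∈ s, w n) * H + E * H ^ 2 := by
  refine (sum_mul_norm_sum_sq_le (b := fun _ ↦ 1) (A := ∑ n ∈ s, w n) hE₀ ?_ ?_).trans_eq ?_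
  · intro k _
    simp only [Circle.norm_coe, one_pow, mul_one, le_refl]
  · intro k _ l hl hkl
    have hdiff (n : ι) : (k : ℝ) * (x n - y) - l * (x n - y) =
        -(((l - k : ℕ) : ℝ) * (x n - y)) := by
      rw [Nat.cast_sub hkl.le]
      ring
    simp only [← coe_fourierChar_sub, hdiff]
    rw [norm_sum_mul_fourierChar_neg, norm_sum_mul_fourierChar_mul_sub, mul_one, mul_one]
    exact hE _ (Nat.sub_pos_of_lt hkl) ((Nat.sub_le _ _).trans_lt (mem_range.1 hl))
  · simp

theorem sum_filter_fract_lt_le (hH : 0 < H) (hw : ∀ n ∈ s, 0 ≤ w n) (hE₀ : 0 ≤ E)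
    (hE : ∀ k : ℕ, 0 < k → k < H → ‖∑ n ∈ s, (w n : ℂ) * 𝐞 (k * x n)‖ ≤ E) {l D : ℝ}
    (hl : 0 ≤ l) (hD : 0 < D) :
    ∑ n ∈ s with Int.fract (x n) < l, w n ≤
      (l + 2 * D + 1 / H + 1 / (4 * H * D ^ 2)) * ∑ n ∈ s, w n + H * E := by
  have hH₀ : (0 : ℝ) < H := by exact_mod_cast hH
  have hW : 0 ≤ ∑ n ∈ s, w n := sum_nonneg hw
  set J := {i ∈ range H | ((i : ℕ) : ℝ) / H ≤ l + 2 * D}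
  have hJ : (#J : ℝ) ≤ (l + 2 * D) * H + 1 := card_filter_div_le hH (by positivity)
  have hJ' : (#J : ℝ) ≤ H := by exact_mod_cast (card_filter_le _ _).trans_eq (card_range H)
  have hmajorant : ∑ n ∈ s with Int.fract (x n) < l, w n * (H : ℝ) ^ 2 ≤
      ∑ n ∈ s, w n * (∑ i ∈ J, ‖expKernel H (x n + D - i / H)‖ ^ 2 + H / (4 * D ^ 2)) := by
    rw [sum_filter]
    refine sum_le_sum fun n hn ↦ ?_
    split_ifs with h
    · exact mul_le_mul_of_nonneg_left (sq_le_sum_norm_expKernel_sq_add hH hD h) (hw n hn)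
    · exact mul_nonneg (hw n hn) (by positivity)
  have hsecond : ∀ i ∈ J, ∑ n ∈ s, w n * ‖expKernel H (x n + D - i / H)‖ ^ 2 ≤
      (∑ n ∈ s, w n) * H + E * H ^ 2 := fun i _ ↦ by
    simpa only [sub_sub_eq_add_sub] using sum_mul_norm_expKernel_sq_le hE₀ hE (i / H - D)
  rw [← mul_le_mul_iff_left₀ (pow_pos hH₀ 2), sum_mul]
  calc ∑ n ∈ s with Int.fract (x n) < l, w n * (H : ℝ) ^ 2
      ≤ ∑ i ∈ J, ∑ n ∈ s, w n * ‖expKernel H (x n + D - i / H)‖ ^ 2 +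
          (∑ n ∈ s, w n) * (H / (4 * D ^ 2)) := by
        simpa only [mul_add, sum_add_distrib, mul_sum, sum_mul, sum_comm (s := s) (t := J)]
          using hmajorant
    _ ≤ #J * ((∑ n ∈ s, w n) * H + E * H ^ 2) + (∑ n ∈ s, w n) * (H / (4 * D ^ 2)) := by
        rw [← nsmul_eq_mul]
        gcongr
        exact sum_le_card_nsmul _ _ _ hsecond
    _ ≤ ((l + 2 * D) * H + 1) * ((∑ n ∈ s, w n) * H) + H * (E * H ^ 2) +
          (∑ n ∈ s, w n) * (H / (4 * D ^ 2)) := by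
        rw [mul_add (#J : ℝ)]
        gcongr
    _ = ((l + 2 * D + 1 / H + 1 / (4 * H * D ^ 2)) * ∑ n ∈ s, w n + H * E) * (H : ℝ) ^ 2 := by
        field_simp
        ring

lemma fract_lt_iff_exists {y l : ℝ} (hl : l ≤ 1) :
    Int.fract y < l ↔ ∃ k : ℤ, k ≤ y ∧ y < k + l := by
  constructor
  · intro h
    exact ⟨⌊y⌋, Int.floor_le y, by linarith [Int.floor_add_fract y]⟩
  · rintro ⟨k, hk₁, hk₂⟩
    have hk : ⌊y⌋ = k := Int.floor_eq_iff.2 ⟨hk₁, by linarith⟩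
    rw [← Int.self_sub_floor, hk]
    linarith

lemma fract_sub_lt_one_sub_iff {y l : ℝ} (hl₀ : 0 ≤ l) (hl₁ : l ≤ 1) :
    Int.fract (y - l) < 1 - l ↔ ¬ Int.fract y < l := by
  have hy₀ := Int.fract_nonneg y
  have hy₁ := Int.fract_lt_one y
  have hsplit := Int.floor_add_fract y
  rw [not_lt]
  rcases le_or_gt l (Int.fract y) with h | h
  · have heq : Int.fract (y - l) = Int.fract y - l :=
      Int.fract_eq_iff.2 ⟨by linarith, by linarith, ⌊y⌋, by linarith⟩
    exact iff_of_true (by linarith) h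
  · have heq : Int.fract (y - l) = Int.fract y - l + 1 :=
      Int.fract_eq_iff.2 ⟨by linarith, by linarith, ⌊y⌋ - 1, by push_cast; linarith⟩
    exact iff_of_false (by linarith) h.not_ge

theorem abs_sum_filter_fract_lt_sub_le (hH : 0 < H) (hw : ∀ n ∈ s, 0 ≤ w n) (hE₀ : 0 ≤ E)
    (hE : ∀ k : ℕ, 0 < k → k < H → ‖∑ n ∈ s, (w n : ℂ) * 𝐞 (k * x n)‖ ≤ E) {l D : ℝ}
    (hl₀ : 0 ≤ l) (hl₁ : l ≤ 1) (hD : 0 < D) :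
    |∑ n ∈ s with Int.fract (x n) < l, w n - l * ∑ n ∈ s, w n| ≤
      (2 * D + 1 / H + 1 / (4 * H * D ^ 2)) * ∑ n ∈ s, w n + H * E := by
  have harc := sum_filter_fract_lt_le hH hw hE₀ hE hl₀ hD
  have hcompl := sum_filter_fract_lt_le (x := fun n ↦ x n - l) hH hw hE₀
    (fun k hk hkH ↦ (norm_sum_mul_fourierChar_mul_sub s w x k l).trans_le (hE k hk hkH))
    (sub_nonneg.2 hl₁) hD
  simp only [fract_sub_lt_one_sub_iff hl₀ hl₁] at hcompl
  have hsplit := sum_filter_add_sum_filter_not s (fun n ↦ Int.fract (x n) < l) w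
  rw [abs_le]
  constructor <;> linarith

lemma abs_sum_filter_fract_lt_sub_le_div {P : ℝ} (hP : 1 ≤ P) (hw : ∀ n ∈ s, 0 ≤ w n) (hE₀ : 0 ≤ E)
    (hE : ∀ k : ℕ, 0 < k → (k : ℝ) ≤ P ^ 3 → ‖∑ n ∈ s, (w n : ℂ) * 𝐞 (k * x n)‖ ≤ E) {l : ℝ}
    (hl₀ : 0 ≤ l) (hl₁ : l ≤ 1) :
    |∑ n ∈ s with Int.fract (x n) < l, w n - l * ∑ n ∈ s, w n| ≤
      4 / P * ∑ n ∈ s, w n + 2 * P ^ 3 * E := by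
  have hP₀ : 0 < P := one_pos.trans_le hP
  have hH₁ : P ^ 3 ≤ ⌈P ^ 3⌉₊ := Nat.le_ceil _
  have hH₂ : (⌈P ^ 3⌉₊ : ℝ) ≤ 2 * P ^ 3 := by
    linarith [Nat.ceil_lt_add_one (pow_pos hP₀ 3).le, one_le_pow₀ hP (n := 3)]
  refine (abs_sum_filter_fract_lt_sub_le (Nat.ceil_pos.2 (pow_pos hP₀ 3)) hw hE₀
    (fun k hk hkH ↦ hE k hk (Nat.lt_ceil.1 hkH).le) hl₀ hl₁ (inv_pos.2 hP₀)).trans ?_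
  gcongr
  · exact sum_nonneg hw
  · have hone : 1 / (⌈P ^ 3⌉₊ : ℝ) ≤ 1 / P := by
      gcongr
      exact (le_self_pow₀ hP (by norm_num)).trans hH₁
    have htail : 1 / (4 * (⌈P ^ 3⌉₊ : ℝ) * P⁻¹ ^ 2) ≤ 1 / P := by
      calc 1 / (4 * (⌈P ^ 3⌉₊ : ℝ) * P⁻¹ ^ 2) ≤ 1 / (4 * P ^ 3 * P⁻¹ ^ 2) := by gcongr
        _ = 1 / (4 * P) := by field_simp
        _ ≤ 1 / P := by
            gcongr
            linarith
    calc 2 * P⁻¹ + 1 / (⌈P ^ 3⌉₊ : ℝ) + 1 / (4 * (⌈P ^ 3⌉₊ : ℝ) * P⁻¹ ^ 2)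
        ≤ 2 * P⁻¹ + 1 / P + 1 / P := by gcongr
      _ = 4 / P := by ring

end

lemma floor_modEq_iff_fract_lt {y : ℝ} (hy : 0 ≤ y) {m u : ℕ} (hm : 0 < m) :
    ⌊y⌋₊ ≡ u [MOD m] ↔ Int.fract ((y - u) / m) < 1 / m := by
  have hm₀ : (0 : ℝ) < m := by exact_mod_cast hm
  have hm₁ : (1 : ℝ) ≤ m := by exact_mod_cast hm
  rw [fract_lt_iff_exists ((div_le_one hm₀).2 hm₁), Nat.ModEq.comm, Nat.modEq_iff_dvd, dvd_def,
    Int.natCast_floor_eq_floor hy]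
  refine exists_congr fun k ↦ ?_
  rw [sub_eq_iff_eq_add', Int.floor_eq_iff, le_div_iff₀ hm₀, div_lt_iff₀ hm₀, add_mul,
    one_div_mul_cancel hm₀.ne']
  push_cast
  constructor <;> rintro ⟨h₁, h₂⟩ <;> constructor <;> linarith

lemma exists_norm_sum_vonMangoldt_mul_fourierChar_div_le {c : ℝ} (hc : 1 < c)
    (hcZ : ∀ k : ℤ, c ≠ k) :
    ∃ θ η C : ℝ, 0 < θ ∧ 0 < η ∧ η ≤ 1 ∧ 0 ≤ C ∧ ∀ N m k : ℕ, 1 ≤ N → 0 < m → 0 < k →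
      (m : ℝ) ≤ (N : ℝ) ^ θ → (k : ℝ) ≤ (N : ℝ) ^ θ → ∀ u : ℝ,
        ‖∑ n ∈ Ioc 0 N, (Λ n : ℂ) * 𝐞 (k * (((n : ℝ) ^ c - u) / m))‖ ≤ C * (N : ℝ) ^ (1 - η) := by
  obtain ⟨θ, η, C, hθ₀, hη₀, hη₁, hC₀, hC⟩ := exists_norm_sum_vonMangoldt_mul_fourierChar_le hc hcZ
  refine ⟨θ, η, C, hθ₀, hη₀, hη₁, hC₀, fun N m k hN hm hk hmN hkN u ↦ ?_⟩
  have hm₁ : (1 : ℝ) ≤ m := by exact_mod_cast hm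
  have hk₁ : (1 : ℝ) ≤ k := by exact_mod_cast hk
  simp only [mul_div_left_comm (k : ℝ), mul_comm (_ - _) (k / m : ℝ)]
  rw [norm_sum_mul_fourierChar_mul_sub]
  refine hC N _ hN ?_ ((div_le_self k.cast_nonneg hm₁).trans hkN)
  rw [rpow_neg N.cast_nonneg, inv_eq_one_div]
  gcongr

theorem exists_abs_sum_vonMangoldt_floor_modEq_sub_le {c : ℝ} (hc : 1 < c)
    (hcZ : ∀ k : ℤ, c ≠ k) :
    ∃ ρ C : ℝ, 0 < ρ ∧ ρ ≤ 1 ∧ 0 ≤ C ∧ ∀ N m u : ℕ, 1 ≤ N → 0 < m → (m : ℝ) ≤ (N : ℝ) ^ ρ →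
      |∑ n ∈ Ioc 0 N with ⌊((n : ℕ) : ℝ) ^ c⌋₊ ≡ u [MOD m], Λ n - 1 / m * ∑ n ∈ Ioc 0 N, Λ n| ≤
        C * (N : ℝ) ^ (1 - ρ) := by
  obtain ⟨θ, η, C, hθ₀, hη₀, hη₁, hC₀, hC⟩ :=
    exists_norm_sum_vonMangoldt_mul_fourierChar_div_le hc hcZ
  obtain ⟨ρ, hρ₀, hρθ, hρη⟩ : ∃ ρ : ℝ, 0 < ρ ∧ 3 * ρ ≤ θ ∧ 6 * ρ ≤ η :=
    ⟨min (θ / 3) (η / 6), by positivity, by linarith [min_le_left (θ / 3) (η / 6)],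
      by linarith [min_le_right (θ / 3) (η / 6)]⟩
  refine ⟨ρ, 24 + 2 * C, hρ₀, by linarith, by positivity, fun N m u hN hm hmN ↦ ?_⟩
  have hN₁ : (1 : ℝ) ≤ N := by exact_mod_cast hN
  have hN₀ : (0 : ℝ) < N := one_pos.trans_le hN₁
  have hm₁ : (1 : ℝ) ≤ m := by exact_mod_cast hm
  have hcube : ((N : ℝ) ^ ρ) ^ 3 = (N : ℝ) ^ (3 * ρ) := by
    rw [← rpow_mul_natCast hN₀.le, mul_comm, Nat.cast_ofNat]
  have hexp (k : ℕ) (hk : 0 < k) (hkN : (k : ℝ) ≤ ((N : ℝ) ^ ρ) ^ 3) :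
      ‖∑ n ∈ Ioc 0 N, (Λ n : ℂ) * 𝐞 (k * (((n : ℝ) ^ c - u) / m))‖ ≤ C * (N : ℝ) ^ (1 - η) :=
    hC N m k hN hm hk (hmN.trans (rpow_le_rpow_of_exponent_le hN₁ (by linarith)))
      ((hkN.trans_eq hcube).trans (rpow_le_rpow_of_exponent_le hN₁ hρθ)) u
  rw [filter_congr fun n _ ↦ floor_modEq_iff_fract_lt (rpow_nonneg n.cast_nonneg c) hm]
  calc |∑ n ∈ Ioc 0 N with Int.fract ((((n : ℕ) : ℝ) ^ c - u) / m) < 1 / m, Λ n -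
        1 / m * ∑ n ∈ Ioc 0 N, Λ n|
      ≤ 4 / (N : ℝ) ^ ρ * ∑ n ∈ Ioc 0 N, Λ n +
          2 * ((N : ℝ) ^ ρ) ^ 3 * (C * (N : ℝ) ^ (1 - η)) :=
        abs_sum_filter_fract_lt_sub_le_div (one_le_rpow hN₁ hρ₀.le)
          (fun _ _ ↦ ArithmeticFunction.vonMangoldt_nonneg) (by positivity) hexp (by positivity)
          ((div_le_one (one_pos.trans_le hm₁)).2 hm₁)
    _ ≤ 4 / (N : ℝ) ^ ρ * (6 * N) + 2 * ((N : ℝ) ^ ρ) ^ 3 * (C * (N : ℝ) ^ (1 - η)) := by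
        gcongr
        exact sum_Ioc_vonMangoldt_le N
    _ = 24 * (N : ℝ) ^ (1 - ρ) + 2 * C * (N : ℝ) ^ (3 * ρ + (1 - η)) := by
        rw [hcube, rpow_add hN₀, rpow_sub hN₀ 1 ρ, rpow_one]
        ring
    _ ≤ 24 * (N : ℝ) ^ (1 - ρ) + 2 * C * (N : ℝ) ^ (1 - ρ) := by
        gcongr
        linarith
    _ = (24 + 2 * C) * (N : ℝ) ^ (1 - ρ) := by ring

lemma rpow_one_sub_le_div_rpow {x y ρ : ℝ} (hx : 1 ≤ x) (hy : 0 < y) (hρ₀ : 0 ≤ ρ) (hρ₁ : ρ ≤ 1)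
    (h : y ≤ x ^ (ρ / 2)) : x ^ (1 - ρ) ≤ (x / y) ^ (1 - ρ / 2) := by
  have hx₀ : 0 < x := one_pos.trans_le hx
  have hratio : x ^ (1 - ρ / 2) ≤ x / y := by
    rw [le_div_iff₀ hy, rpow_sub hx₀, rpow_one, div_mul_eq_mul_div, div_le_iff₀ (by positivity)]
    gcongr
  calc x ^ (1 - ρ) ≤ x ^ ((1 - ρ / 2) * (1 - ρ / 2)) := by
        gcongr
        nlinarith
    _ = (x ^ (1 - ρ / 2)) ^ (1 - ρ / 2) := rpow_mul hx₀.le _ _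
    _ ≤ (x / y) ^ (1 - ρ / 2) := by
        gcongr
        linarith

theorem mainTheorem11 (c : ℝ) (hc : 1 < c) (hcZ : ∀ k : ℤ, c ≠ (k : ℝ)) :
    ∃ θ : ℝ, 0 < θ ∧ ∃ δ : ℝ, 0 < δ ∧ ∃ C : ℝ, ∀ N m u : ℕ,
      1 ≤ m → (m : ℝ) ≤ (N : ℝ) ^ θ → u < m →
        |(∑ n ∈ (Finset.Icc 1 N).filter (fun n : ℕ => ⌊(n : ℝ) ^ c⌋₊ ≡ u [MOD m]),
              ArithmeticFunction.vonMangoldt n)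
            - Chebyshev.psi (N : ℝ) / (m : ℝ)|
          ≤ C * ((N : ℝ) / (m : ℝ)) ^ (1 - δ) := by
  obtain ⟨ρ, C, hρ₀, hρ₁, hC₀, hC⟩ := exists_abs_sum_vonMangoldt_floor_modEq_sub_le hc hcZ
  refine ⟨ρ / 2, by positivity, ρ / 2, by positivity, C, fun N m u hm hmN _ ↦ ?_⟩
  have hm₀ : (0 : ℝ) < m := by exact_mod_cast hm
  have hN : 1 ≤ N := by
    rw [Nat.one_le_iff_ne_zero]
    rintro rfl
    rw [Nat.cast_zero, zero_rpow (by positivity)] at hmN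
    exact hm₀.not_ge hmN
  have hN₁ : (1 : ℝ) ≤ N := by exact_mod_cast hN
  have hequidistribution := hC N m u hN hm (hmN.trans (by gcongr; linarith))
  rw [show Icc 1 N = Ioc 0 N from Icc_succ_left_eq_Ioc 0 N, Chebyshev.psi, Nat.floor_natCast,
    div_eq_mul_one_div, mul_comm _ (1 / (m : ℝ))]
  exact hequidistribution.trans <| mul_le_mul_of_nonneg_left
    (rpow_one_sub_le_div_rpow hN₁ hm₀ hρ₀.le (by linarith) hmN) hC₀
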